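/- Two agents $1,2$ with budgets $B_1,B_2>0$ and per-item values $v_1,v_2$ take part in a sequential auction of $k$ identical items, sold one after the other by first-price sealed-bid auctions; it is assumed that $v_i>2^kB_j$ for all $i,j\in\{1,2\}$. A bid is $p$ or $p+$ with $p\ge 0$, where $p+$ is infinitesimally larger than $p$; the higher bid wins, the winner pays her $p$, and equal bids are resolved by a fair coin. An agent's utility is the total value of the items she wins plus the budget she has left. We write $-i$ for the opponent of $i$. The *canonical outcome* is defined recursively. Let $U^{(m)}_i(B_i,B_{-i})$ be the expected utility of agent $i$ in the canonical outcome with $m$ items, $U^{(0)}_i=B_i$. With $m$ items left and current budgets $B_1,B_2$, let $W_i(p)=v_i+U^{(m-1)}_i(B_i-p,B_{-i})$ and $L_i(p)=U^{(m-1)}_i(B_i,\max(B_{-i}-p,0))$, and let the critical price be $p_i=\sup\{p\in[0,B_i]: W_i(p)>L_i(p)\}$, i.e. the price in $[0,B_i]$ below which $i$ strictly prefers winning the current item and above which she strictly prefers losing it. If $p_i>p_{-i}$ then $i$ bids $p_{-i}+$ and $-i$ bids $p_{-i}$; if $p_1=p_2$ both bid $p_1$ (a tie). Both then continue with the canonical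 outcome for $m-1$ items. A *realization* is a sequence of winners and prices which has positive probability in the canonical outcome. Let $k_1,k_2\ge 0$ be integers with $k_1+k_2=k$ and $\frac{k_1}{k_2+1}\le\frac{B_1}{B_2}<\frac{k_1+1}{k_2}$ (no upper bound if $k_2=0$). A realization is *two-phase with $i$ first* if agent $i$ wins the first $k_i$ items and agent $-i$ wins the remaining $k_{-i}$ items, paying for each of them the budget that $i$ has left after the first phase. A *Type II-B tie with parameters $(k_i,k_{-i},p^*)$* is the following behaviour: both agents keep bidding $p^*$ until either $i$ has won $k_i$ items or $-i$ has won $k_{-i}-1$ items; in the former case $-i$ wins the remaining items, bidding $p^*+$ against $p^*$, where $p^*$ is the budget that $i$ has left; in the latter case $i$ bids $p^*+$ against $p^*$ until she has won $k_i$ items, and then $-i$ wins the remaining items, again bidding $p^*+$ against $p^*$, where $p^*$ is the budget $i$ has left. Then: 1. (Type I) If $\frac{B_1}{B_2}=\frac{k_1}{k_2+1}$, then with $p^*=\frac{B_1}{k_1}=\frac{B_2}{k_2+1}$ both agents keep bidding $p^*$ until one of them has no budget left, and then the other agent wins all remaining items for free (bidding $0+$ against $0$). 2. If $\frac{k_1}{k_2+1}<\frac{B_1}{B_2}<\frac{k_1+1}{k_2+1}$,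 put $i=1$; if $\frac{k_1+1}{k_2+1}<\frac{B_1}{B_2}$, put $i=2$. Then agent $i$ wins the first $k_i$ items and agent $-i$ the rest, up to ties that do not matter. Precisely: (a) some realization is two-phase with $i$ first; (b) in every realization each agent $j$ wins exactly $k_j$ items and her utility equals $U^{(k)}_j$; (c) either all realizations are two-phase with $i$ first, or there is $0\le\ell<k_i$ such that agent $i$ wins the first $\ell$ items at prices that are the same in all realizations, and the rest of the auction is a Type II-B tie with parameters $\left(k_i-\ell,\,k_{-i},\,\frac{B_i'}{k_i-\ell+1}\right)$, where $B'_i$ is the budget of $i$ after these $\ell$ rounds. 3. (Type II-A) If $\frac{B_1}{B_2}=\frac{k_1+1}{k_2+1}$, then with $p^*=\frac{B_1}{k_1+1}=\frac{B_2}{k_2+1}$ both agents keep bidding $p^*$ until the budget of one of them is $p^*$, and then the other agent wins all remaining items by bidding $p^*+$ against $p^*$. For both $i=1$ and $i=2$ some realization is two-phase with $i$ first, and in every realization each agent $j$ wins exactly $k_j$ items and her utility equals $U^{(k)}_j$. 4. (Type II-B) For $i\in\{1,2\}$ and integers $k_i\ge0$, $k_{-i}\ge1$ with $k_1+k_2=k$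 there is $\delta>0$, depending only on $i,k_1,k_2$, such that for all budgets and values as above with $\frac{k_i+1}{k_{-i}+1}-\delta<\frac{B_i}{B_{-i}}<\frac{k_i+1}{k_{-i}+1}$, the canonical outcome is a Type II-B tie with parameters $\left(k_i,k_{-i},\frac{B_i}{k_i+1}\right)$, some realization is two-phase with $i$ first, and in every realization each agent $j$ wins exactly $k_j$ items and her utility equals $U^{(k)}_j$. -/

import Mathlib

/-- The two agents: `0` is agent 1 and `1` is agent 2. -/
abbrev Agent := Fin 2

/-- The opponent `-i` of agent `i`. -/
def opp (i : Agent) : Agent := 1 - i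

/-- A bid: `⟨p, false⟩` is the bid `p`, and `⟨p, true⟩` is the bid `p+`. -/
structure Bid where
  amount : ℝ
  plus : Bool

/-- `x.Beats y`: the bid `x` is strictly higher than the bid `y`, where `p+` lies just above `p`. -/
def Bid.Beats (x y : Bid) : Prop :=
  y.amount < x.amount ∨ (y.amount = x.amount ∧ y.plus = false ∧ x.plus = true)

open Classical in
/-- The probability that the bid `x` wins against the bid `y`; a tie is broken by a fair coin. -/
noncomputable def winProb (x y : Bid) : ℝ :=
  if x.Beats y then 1 else if y.Beats x then 0 else 1 / 2

/-- The budgets after agent `i` has paid `p`. (An agent never pays more than her budget in the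
canonical outcome. The truncation at `0` only serves to evaluate the losing utility of an agent at
a price that her opponent cannot afford: the opponent then counts as having nothing left.) -/
noncomputable def pay (b : Agent → ℝ) (i : Agent) (p : ℝ) : Agent → ℝ :=
  Function.update b i (max (b i - p) 0)

/-- The utility of agent `i` from winning the first item at price `p`,
if `U` gives the utilities in the rest of the auction. -/
noncomputable def winUtil (v : Agent → ℝ) (U : (Agent → ℝ) → Agent → ℝ) (b : Agent → ℝ)
    (i : Agent) (p : ℝ) : ℝ :=
  v i + U (pay b i p) i

/-- The utility of agent `i` when her opponent wins the first item at price `p`. -/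
noncomputable def loseUtil (U : (Agent → ℝ) → Agent → ℝ) (b : Agent → ℝ)
    (i : Agent) (p : ℝ) : ℝ :=
  U (pay b (opp i) p) i

/-- The critical price of agent `i`: among the prices `p ∈ [0, b i]` that she can pay, the threshold
below which she strictly prefers winning the first item and above which she strictly prefers
losing it (see `critPrice_eq`). It is the whole budget `b i` if she prefers winning at every
price that she can pay. -/
noncomputable def critPrice (v : Agent → ℝ) (U : (Agent → ℝ) → Agent → ℝ) (b : Agent → ℝ)
    (i : Agent) : ℝ :=
  sSup {p : ℝ | 0 ≤ p ∧ p ≤ b i ∧ loseUtil U b i p < winUtil v U b i p}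

open Classical in
/-- The first-round bid of agent `i` in the canonical outcome, when `U` gives the utilities in the
rest of the auction: both agents bid the lower critical price, and the agent with the strictly
higher critical price adds the `+`. -/
noncomputable def bidGiven (v : Agent → ℝ) (U : (Agent → ℝ) → Agent → ℝ) (b : Agent → ℝ)
    (i : Agent) : Bid :=
  ⟨min (critPrice v U b i) (critPrice v U b (opp i)),
    decide (critPrice v U b (opp i) < critPrice v U b i)⟩

/-- `canonUtil v m b i` is the expected utility (value of the items won plus remaining budget) of
agent `i` in the canonical outcome with `m` items and budgets `b`. -/
noncomputable def canonUtil (v : Agent → ℝ) : ℕ → (Agent → ℝ) → Agent → ℝ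
  | 0 => fun b i => b i
  | m + 1 => fun b i =>
      let x := bidGiven v (canonUtil v m) b
      winProb (x i) (x (opp i)) * winUtil v (canonUtil v m) b i (x i).amount +
        winProb (x (opp i)) (x i) * loseUtil (canonUtil v m) b i (x (opp i)).amount

/-- The bid of agent `i` in the canonical outcome when the current budgets are `b`, one item is
being sold, and `m` further items are sold after it. -/
noncomputable def canonBid (v : Agent → ℝ) (m : ℕ) (b : Agent → ℝ) (i : Agent) : Bid :=
  bidGiven v (canonUtil v m) b i

/-- `Reach v k b h m c`: starting with `k` items and budgets `b`, the canonical outcome leads with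
positive probability through the rounds recorded in `h` (winner and price paid, in chronological
order) to the situation in which `m` items are left and the remaining budgets are `c`. -/
inductive Reach (v : Agent → ℝ) :
    ℕ → (Agent → ℝ) → List (Agent × ℝ) → ℕ → (Agent → ℝ) → Prop
  | refl (k : ℕ) (b : Agent → ℝ) : Reach v k b [] k b
  | round {k : ℕ} {b : Agent → ℝ} {i : Agent} {h : List (Agent × ℝ)} {m : ℕ} {c : Agent → ℝ}
      (hwin : ¬ (canonBid v k b (opp i)).Beats (canonBid v k b i))
      (hrest : Reach v k (pay b i (canonBid v k b i).amount) h m c) :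
      Reach v (k + 1) b ((i, (canonBid v k b i).amount) :: h) m c

/-- The number of items that agent `i` wins in the rounds `h`. -/
def itemsWon (h : List (Agent × ℝ)) (i : Agent) : ℕ := (h.map Prod.fst).count i

/-- The rounds `h` form a two-phase sequence: agent `i` wins the first `k i` items, then agent `-i`
wins the other `k (-i)` items, paying for each of them the budget that agent `i` has left. -/
def IsTwoPhase (k : Agent → ℕ) (i : Agent) (b : Agent → ℝ) (h : List (Agent × ℝ)) : Prop :=
  h.map Prod.fst = List.replicate (k i) i ++ List.replicate (k (opp i)) (opp i) ∧
    ∀ x ∈ h.drop (k i), x.2 = b i - ((h.take (k i)).map Prod.snd).sum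

/-- Type I: both agents keep bidding `p` until one of them has no budget left, and from then on the
other agent wins every item at price `0`. -/
def TypeITie (v : Agent → ℝ) (n : ℕ) (b : Agent → ℝ) (p : ℝ) : Prop :=
  ∀ h m c, Reach v n b h (m + 1) c →
    (∀ j, 0 < c j ∧ canonBid v m c j = ⟨p, false⟩) ∨
    (∃ j, c j = 0 ∧ canonBid v m c j = ⟨0, false⟩ ∧ canonBid v m c (opp j) = ⟨0, true⟩)

/-- Type II-A: both agents keep bidding `p` until the budget of one of them is `p`, and from then on
the other agent wins every item by bidding `p+` against `p`. -/
def TypeIIATie (v : Agent → ℝ) (n : ℕ) (b : Agent → ℝ) (p : ℝ) : Prop :=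
  ∀ h m c, Reach v n b h (m + 1) c →
    (∀ j, p < c j ∧ canonBid v m c j = ⟨p, false⟩) ∨
    (∃ j, c j = p ∧ canonBid v m c j = ⟨p, false⟩ ∧ canonBid v m c (opp j) = ⟨p, true⟩)

/-- Type II-B, with `k 0 + k 1` items: both agents keep bidding `p` until agent `i` has won `k i`
items or agent `-i` has won `k (-i) - 1` items. In the former case agent `-i` wins all the remaining
items, bidding `p+` against `p`, where `p` is the budget that agent `i` has left. In the latter case
agent `i` bids `p+` against `p` until she has won `k i` items, and then agent `-i` wins the
remaining items in the same way as before. -/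
def TypeIIBTie (v : Agent → ℝ) (k : Agent → ℕ) (i : Agent) (b : Agent → ℝ) (p : ℝ) : Prop :=
  ∀ h m c, Reach v (k 0 + k 1) b h (m + 1) c →
    (itemsWon h i < k i ∧ itemsWon h (opp i) + 1 < k (opp i) ∧
      ∀ j, canonBid v m c j = ⟨p, false⟩) ∨
    (itemsWon h i = k i ∧ c i = p ∧
      canonBid v m c i = ⟨p, false⟩ ∧ canonBid v m c (opp i) = ⟨p, true⟩) ∨
    (itemsWon h i < k i ∧ itemsWon h (opp i) + 1 = k (opp i) ∧
      canonBid v m c i = ⟨p, true⟩ ∧ canonBid v m c (opp i) = ⟨p, false⟩)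

/-- Every realization of the canonical outcome with `k 0 + k 1` items gives each agent `j` exactly
`k j` items and exactly the utility that she expects, so that how ties are broken is irrelevant. -/
def TiesIrrelevant (v : Agent → ℝ) (k : Agent → ℕ) (b : Agent → ℝ) : Prop :=
  ∀ h c, Reach v (k 0 + k 1) b h 0 c → ∀ j,
    itemsWon h j = k j ∧ v j * k j + c j = canonUtil v (k 0 + k 1) b j

/-- Some realization of the canonical outcome is the two-phase sequence in which agent `i` is the
first to win. -/
def TwoPhasePossible (v : Agent → ℝ) (k : Agent → ℕ) (i : Agent) (b : Agent → ℝ) : Prop :=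
  ∃ h c, Reach v (k 0 + k 1) b h 0 c ∧ IsTwoPhase k i b h

/-- All realizations of the canonical outcome are two-phase sequences in which agent `i` is the
first to win, or else the canonical outcome certainly starts with some number (less than `k i`,
possibly zero) of wins of agent `i`, after which the rest of the auction is a Type II-B tie. -/
def TwoPhaseOrTie (v : Agent → ℝ) (k : Agent → ℕ) (i : Agent) (b : Agent → ℝ) : Prop :=
  (∀ h c, Reach v (k 0 + k 1) b h 0 c → IsTwoPhase k i b h) ∨
  ∃ g m d, Reach v (k 0 + k 1) b g m d ∧ g.length < k i ∧ (∀ x ∈ g, x.1 = i) ∧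
    (∀ h c, Reach v (k 0 + k 1) b h 0 c → g <+: h) ∧
    TypeIIBTie v (Function.update k i (k i - g.length)) i d
      (d i / ((k i : ℝ) - g.length + 1))

/-- The critical price is the threshold price whenever there is one. -/
theorem critPrice_eq {v : Agent → ℝ} {U : (Agent → ℝ) → Agent → ℝ} {b : Agent → ℝ} {i : Agent}
    {p : ℝ} (h0 : 0 ≤ p) (hb : p ≤ b i)
    (hlt : ∀ q, 0 ≤ q → q < p → loseUtil U b i q < winUtil v U b i q)
    (hgt : ∀ q, p < q → q ≤ b i → winUtil v U b i q < loseUtil U b i q) :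
    critPrice v U b i = p := by
  have hub : ∀ q ∈ {q : ℝ | 0 ≤ q ∧ q ≤ b i ∧ loseUtil U b i q < winUtil v U b i q}, q ≤ p := by
    rintro q ⟨-, hq1, hq2⟩
    by_contra hc
    exact absurd hq2 (not_lt.mpr (hgt q (not_le.mp hc) hq1).le)
  unfold critPrice
  apply le_antisymm
  · exact Real.sSup_le hub h0
  · by_contra hc
    rw [not_le] at hc
    have hp : 0 < p := lt_of_le_of_lt (Real.sSup_nonneg (fun q hq => hq.1)) hc
    obtain ⟨q, hq1, hq2⟩ := exists_between (max_lt hc hp)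
    have hq0 : 0 ≤ q := (le_max_right _ _).trans hq1.le
    have := le_csSup (a := q) ⟨p, hub⟩ ⟨hq0, hq2.le.trans hb, hlt q hq0 hq2⟩
    exact absurd (lt_of_le_of_lt (le_max_left _ _) hq1) (not_lt.mpr this)

/-- With a single item, both agents bid the smaller budget, and an agent with a strictly larger
budget adds the `+`. -/
theorem canonBid_single {v b : Agent → ℝ} (hb : ∀ j, 0 ≤ b j) (hv : ∀ j, b j < v j) (i : Agent) :
    canonBid v 0 b i = ⟨min (b i) (b (opp i)), decide (b (opp i) < b i)⟩ := by
  have key : ∀ j, critPrice v (canonUtil v 0) b j = b j := by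
    intro j
    refine critPrice_eq (hb j) le_rfl (fun q _ hq => ?_) (fun q h1 h2 => absurd h1 (not_lt.mpr h2))
    have hne : j ≠ opp j := by fin_cases j <;> decide
    have h1 : pay b j q j = b j - q := by
      simp [pay, max_eq_left (sub_nonneg.mpr hq.le)]
    have h2 : pay b (opp j) q j = b j := by simp [pay, hne]
    simp only [loseUtil, winUtil, canonUtil, h1, h2]
    linarith [hv j]
  simp [canonBid, bidGiven, key]

/-! Items are worth far more than money, so the number of items won dominates every comparison. With
m items left, call the budgets (x, y) in the cell (k, l), k + l = m, if k y < (l+1) x and l x <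
(k+1) y. Inside a cell the split (k, l) is certain and only money is at stake; on the lines k y =
(l+1) x between cells the split depends on coin tosses (Type I). The middle line (l+1) x = (k+1) y
of a cell decides who wins first. By symmetry it is enough to study the lower half (l+1) x ≤ (k+1)
y, where the agent with budget x, the first agent, should win her k items first.

In that half everything is measured by the first agent's final budget, since the opponent later pays
exactly this amount for each of his items. Write p for the price of the current item, T for her
final budget if she takes it at price p, and Y for her final budget if the opponent takes it at p
("lost" and "won" in lemma names are the opponent's view). If the opponent is to win l + 1 items in
all, he is indifferent when p + l Y = (l+1) T. There is also a floor: below it his winning would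
carry the budgets into the next cell and give him one item more, so he certainly wants to win. The
larger of the floor and the root of the indifference equation is his critical price; this is the
recursion behind `leftover` and `price`.

The crux is `leftover_le_price`: p ≥ T. It is proved by comparing the two orders in which the first
agent and the opponent can take the next two items. With the indifference equation it gives Y ≤ T
for l > 0 (`won_le_lost`; l = 0 is `won_lt_lost`), so the first agent wants the item at least as
much as the opponent and either outbids him or ties. A tie means Y = T, hence p = T, and inductively
every later price of the phase is T as well, so the first agent's budget is divided into equal
shares (`leftover_of_won_eq_lost`). This is the Type II-B tie, and since Y = T the coin has no
influence on the final money.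

Induction on the number of items turns this into a formula for the expected utility in every cell
(`UtilSpec`). It must be carried along with crude bounds on the boundary lines, where repeated ties
may leave only a 2^(-m) share of the value of an item as surplus; the factor 2^k in the hypothesis
makes that surplus exceed the budget. The utilities determine the critical prices (`crit_lower`,
`crit_mid`, `crit_boundary`), and the realizations are then followed round by round by means of
invariants. -/

/-! ### The budget that the first agent has left -/

/-- The price at which the opponent is indifferent, if `f` and `g` are the leftover functions after
the first item is won and lost. -/
noncomputable def rootPrice (f g : ℝ → ℝ → ℝ) (l : ℕ) (a b : ℝ) : ℝ :=
  Classical.epsilon fun p => p + l * g a (b - p) = (l + 1) * f (a - p) b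

/-- The price of the first item, when `k + 1` items go to the first agent, who has budget `a`, and
`l + 1` items go to the second agent, who has budget `b`. -/
noncomputable def firstPrice (f g : ℝ → ℝ → ℝ) (k l : ℕ) (a b : ℝ) : ℝ :=
  max (b - a * (l + 1) / (k + 1)) (rootPrice f g l a b)

/-- The budget that an agent with budget `a` has left, if she first wins `k` items against an
opponent with budget `b`, who afterwards wins `l` items. -/
noncomputable def leftover : ℕ → ℕ → ℝ → ℝ → ℝ
  | 0, _ => fun a _ => a
  | k + 1, 0 => fun a b => a - (k + 1) * b
  | k + 1, l + 1 => fun a b =>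
      leftover k (l + 1) (a - firstPrice (leftover k (l + 1)) (leftover (k + 1) l) k l a b) b
  termination_by k l => k + l

/-- The price of the first item when `k + 1` and `l + 1` items go to the two agents. -/
noncomputable def price (k l : ℕ) (a b : ℝ) : ℝ :=
  firstPrice (leftover k (l + 1)) (leftover (k + 1) l) k l a b

theorem leftover_zero (l : ℕ) (a b : ℝ) : leftover 0 l a b = a := by
  rw [leftover]

theorem leftover_succ_zero (k : ℕ) (a b : ℝ) : leftover (k + 1) 0 a b = a - (k + 1) * b := by
  rw [leftover]

theorem leftover_right_zero (k : ℕ) (a b : ℝ) : leftover k 0 a b = a - k * b := by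
  cases k with
  | zero => simp [leftover_zero]
  | succ k => simp [leftover_succ_zero]

theorem leftover_succ (k l : ℕ) (a b : ℝ) :
    leftover (k + 1) (l + 1) a b = leftover k (l + 1) (a - price k l a b) b := by
  rw [leftover]; rfl

/-! ### Monotonicity and Lipschitz continuity of the leftover budget. -/

/-- Regularity of the leftover functions. -/
structure Regular (f : ℝ → ℝ → ℝ) : Prop where
  mono : ∀ {a a'} b, a < a' → f a b < f a' b
  anti : ∀ a {b b'}, b ≤ b' → f a b' ≤ f a b
  lip : ∃ C, 0 ≤ C ∧ ∀ a b a' b', |f a b - f a' b'| ≤ C * (|a - a'| + |b - b'|)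

theorem Regular.mono_le {f : ℝ → ℝ → ℝ} (hf : Regular f) {a a' : ℝ} (b : ℝ) (h : a ≤ a') :
    f a b ≤ f a' b := by
  rcases h.lt_or_eq with h | h
  · exact (hf.mono b h).le
  · rw [h]

theorem Regular.continuous {f : ℝ → ℝ → ℝ} (hf : Regular f) :
    Continuous fun q : ℝ × ℝ => f q.1 q.2 := by
  obtain ⟨C, hC, h⟩ := hf.lip
  refine LipschitzWith.continuous (K := ⟨2 * C, by positivity⟩) (LipschitzWith.of_dist_le_mul ?_)
  rintro ⟨a, b⟩ ⟨a', b'⟩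
  have h1 := h a b a' b'
  have h2 : |a - a'| ≤ dist (a, b) (a', b') := by
    rw [Prod.dist_eq, Real.dist_eq, Real.dist_eq]; exact le_max_left _ _
  have h3 : |b - b'| ≤ dist (a, b) (a', b') := by
    rw [Prod.dist_eq, Real.dist_eq, Real.dist_eq]; exact le_max_right _ _
  rw [Real.dist_eq]
  change |f a b - f a' b'| ≤ 2 * C * _
  nlinarith

section Root

variable {f g : ℝ → ℝ → ℝ} (hf : Regular f) (hg : Regular g) (l : ℕ)
include hf hg

/-- The net gain of the opponent from losing grows at least as fast as the price. -/
theorem excess_growth (a b : ℝ) {p q : ℝ} (h : p ≤ q) :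
    (p + l * g a (b - p) - (l + 1) * f (a - p) b) + (q - p) ≤
      q + l * g a (b - q) - (l + 1) * f (a - q) b := by
  have h1 : g a (b - p) ≤ g a (b - q) := hg.anti a (by linarith)
  have h2 : f (a - q) b ≤ f (a - p) b := hf.mono_le b (by linarith)
  have h3 : (l : ℝ) * g a (b - p) ≤ l * g a (b - q) := by gcongr
  have h4 : ((l : ℝ) + 1) * f (a - q) b ≤ (l + 1) * f (a - p) b := by gcongr
  linarith

/-- The excess F has slope at least one by `excess_growth`, so it is nonnegative at |F 0| and
nonpositive at -|F 0|, and the intermediate value theorem applies. Allowing all real prices and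
budgets avoids any side condition. -/
theorem rootPrice_spec (a b : ℝ) :
    rootPrice f g l a b + l * g a (b - rootPrice f g l a b) =
      (l + 1) * f (a - rootPrice f g l a b) b := by
  unfold rootPrice
  apply Classical.epsilon_spec (p := fun p : ℝ => p + l * g a (b - p) = (l + 1) * f (a - p) b)
  set F : ℝ → ℝ := fun p => p + l * g a (b - p) - (l + 1) * f (a - p) b with hF
  have hc : Continuous F := by
    have h1 : Continuous fun p : ℝ => g a (b - p) :=
      hg.continuous.comp (f := fun p : ℝ => (a, b - p)) (by fun_prop)
    have h2 : Continuous fun p : ℝ => f (a - p) b :=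
      hf.continuous.comp (f := fun p : ℝ => (a - p, b)) (by fun_prop)
    exact (continuous_id.add (continuous_const.mul h1)).sub (continuous_const.mul h2)
  have h0 := abs_nonneg (F 0)
  have h1 : 0 ≤ F |F 0| := by
    have := excess_growth hf hg l a b h0
    have h3 := neg_abs_le (F 0)
    simp only [hF] at *
    linarith
  have h2 : F (-|F 0|) ≤ 0 := by
    have := excess_growth hf hg l a b (p := -|F 0|) (q := 0) (by linarith)
    have h3 := le_abs_self (F 0)
    simp only [hF] at *
    linarith
  obtain ⟨p, -, hp⟩ := intermediate_value_Icc (by linarith : -|F 0| ≤ |F 0|) hc.continuousOn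
    (show (0 : ℝ) ∈ _ from ⟨h2, h1⟩)
  exact ⟨p, by simp only [hF] at hp; linarith⟩

theorem rootPrice_le {a b q : ℝ} (h : (l + 1) * f (a - q) b ≤ q + l * g a (b - q)) :
    rootPrice f g l a b ≤ q := by
  by_contra hc
  have h1 := excess_growth hf hg l a b (not_le.mp hc).le
  have h2 := rootPrice_spec hf hg l a b
  linarith

theorem le_rootPrice {a b q : ℝ} (h : q + l * g a (b - q) ≤ (l + 1) * f (a - q) b) :
    q ≤ rootPrice f g l a b := by
  by_contra hc
  have h1 := excess_growth hf hg l a b (not_le.mp hc).le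
  have h2 := rootPrice_spec hf hg l a b
  linarith

/-- Because the excess has slope at least one in the price, its root moves by no more than the
excess itself changes when the budgets do. -/
theorem rootPrice_lipschitz : ∃ C, 0 ≤ C ∧ ∀ a b a' b',
    |rootPrice f g l a b - rootPrice f g l a' b'| ≤ C * (|a - a'| + |b - b'|) := by
  obtain ⟨C, hC, h⟩ := hf.lip
  obtain ⟨D, hD, h'⟩ := hg.lip
  have key : ∀ a b a' b', rootPrice f g l a b - rootPrice f g l a' b' ≤
      (l * D + (l + 1) * C) * (|a - a'| + |b - b'|) := by
    intro a b a' b'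
    set p := rootPrice f g l a b
    set q := rootPrice f g l a' b'
    have h0 : 0 ≤ |a - a'| + |b - b'| := by positivity
    rcases le_total p q with hpq | hpq
    · have : 0 ≤ (l * D + (l + 1) * C) * (|a - a'| + |b - b'|) := by positivity
      linarith
    have h1 := excess_growth hf hg l a' b' hpq
    have h2 : p + l * g a (b - p) = (l + 1) * f (a - p) b := rootPrice_spec hf hg l a b
    have h3 : q + l * g a' (b' - q) = (l + 1) * f (a' - q) b' := rootPrice_spec hf hg l a' b'
    have h4 := h (a - p) b (a' - p) b'
    have h5 := h' a (b - p) a' (b' - p)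
    rw [sub_sub_sub_cancel_right] at h4 h5
    have h6 : (l : ℝ) * (g a' (b' - p) - g a (b - p)) ≤ l * (D * (|a - a'| + |b - b'|)) := by
      gcongr; linarith [neg_abs_le (g a (b - p) - g a' (b' - p))]
    have h7 : ((l : ℝ) + 1) * (f (a - p) b - f (a' - p) b') ≤
        (l + 1) * (C * (|a - a'| + |b - b'|)) := by
      gcongr; linarith [le_abs_self (f (a - p) b - f (a' - p) b')]
    linarith
  refine ⟨l * D + (l + 1) * C, by positivity, fun a b a' b' => abs_le.mpr ⟨?_, key a b a' b'⟩⟩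
  have := key a' b' a b
  rw [abs_sub_comm a', abs_sub_comm b'] at this
  linarith

theorem regular_step (k : ℕ) : Regular fun a b => f (a - firstPrice f g k l a b) b := by
  have hc : (0 : ℝ) ≤ (l + 1) / (k + 1) := by positivity
  have hfloor : ∀ a b : ℝ, b - a * (l + 1) / (k + 1) = b - a * ((l + 1) / (k + 1)) := by
    intro a b; ring
  refine ⟨?_, ?_, ?_⟩
  · intro a a' b h
    apply hf.mono
    -- A larger budget raises the price by less than the increase of the budget. The floor does not
    -- rise with `a`; a root rising by the full increase would raise the left side of the
    -- indifference equation and not its right side.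
    have : firstPrice f g k l a' b < a' - (a - firstPrice f g k l a b) := by
      unfold firstPrice
      rw [hfloor, hfloor]
      apply max_lt
      · have h1 := le_max_left (b - a * ((l + 1) / (k + 1))) (rootPrice f g l a b)
        nlinarith
      · by_contra hcon
        rw [not_lt] at hcon
        have h1 := le_max_right (b - a * ((l + 1) / (k + 1))) (rootPrice f g l a b)
        set p := rootPrice f g l a b
        set q := rootPrice f g l a' b
        have h2 : p + l * g a (b - p) = (l + 1) * f (a - p) b := rootPrice_spec hf hg l a b
        have h3 : q + l * g a' (b - q) = (l + 1) * f (a' - q) b := rootPrice_spec hf hg l a' b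
        have h4 : g a (b - p) ≤ g a' (b - q) :=
          (hg.mono_le _ h.le).trans (hg.anti a' (by linarith))
        have h5 : f (a' - q) b ≤ f (a - p) b := hf.mono_le b (by linarith)
        have h6 : (l : ℝ) * g a (b - p) ≤ l * g a' (b - q) := by gcongr
        have h7 : ((l : ℝ) + 1) * f (a' - q) b ≤ (l + 1) * f (a - p) b := by gcongr
        linarith
    linarith
  · intro a b b' h
    by_contra hcon
    rw [not_le] at hcon
    set p := firstPrice f g k l a b
    set p' := firstPrice f g k l a b'
    have hp : p' < p := by
      by_contra hle
      exact absurd ((hf.anti _ h).trans (hf.mono_le b (by linarith))) (not_le.mpr hcon)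
    -- The floor rises with `b`, so a price that falls as `b` rises cannot have been the floor. The
    -- indifference equation at `b` then contradicts the sign of the excess at `b'`.
    have hroot : p = rootPrice f g l a b := by
      rcases max_choice (b - a * (l + 1) / (k + 1)) (rootPrice f g l a b) with h1 | h1
      · have h2 : p = b - a * (l + 1) / (k + 1) := h1
        have h3 : b' - a * (l + 1) / (k + 1) ≤ p' := le_max_left _ _
        linarith
      · exact h1
    have h1 := rootPrice_spec hf hg l a b
    rw [← hroot] at h1
    have h4 : rootPrice f g l a b' ≤ p' := le_max_right _ _
    have h2 := excess_growth hf hg l a b' h4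
    have h3 := rootPrice_spec hf hg l a b'
    have h5 : (l : ℝ) * g a (b' - p') ≤ l * g a (b - p) := by
      gcongr; exact hg.anti a (by linarith)
    have h6 : ((l : ℝ) + 1) * f (a - p) b < (l + 1) * f (a - p') b' := by gcongr
    linarith
  · obtain ⟨C, hC, h⟩ := hf.lip
    obtain ⟨D, hD, h'⟩ := rootPrice_lipschitz hf hg l
    set c : ℝ := (l + 1) / (k + 1)
    refine ⟨C * (2 + c + D), by positivity, fun a b a' b' => ?_⟩
    have h1 : |firstPrice f g k l a b - firstPrice f g k l a' b'| ≤
        (1 + c + D) * (|a - a'| + |b - b'|) := by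
      unfold firstPrice
      rw [hfloor, hfloor]
      refine (abs_max_sub_max_le_max _ _ _ _).trans (max_le ?_ ?_)
      · have e : b - a * c - (b' - a' * c) = (b - b') - c * (a - a') := by ring
        rw [e]
        refine (abs_sub _ _).trans ?_
        rw [abs_mul, abs_of_nonneg hc]
        nlinarith [abs_nonneg (a - a'), abs_nonneg (b - b'), mul_nonneg hc (abs_nonneg (b - b')),
          mul_nonneg hD (abs_nonneg (b - b')), mul_nonneg hD (abs_nonneg (a - a'))]
      · refine (h' a b a' b').trans ?_
        have : 0 ≤ |a - a'| + |b - b'| := by positivity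
        nlinarith
    refine (h _ _ _ _).trans ?_
    have h2 : |a - firstPrice f g k l a b - (a' - firstPrice f g k l a' b')| ≤
        |a - a'| + |firstPrice f g k l a b - firstPrice f g k l a' b'| := by
      rw [show a - firstPrice f g k l a b - (a' - firstPrice f g k l a' b') =
        (a - a') - (firstPrice f g k l a b - firstPrice f g k l a' b') by ring]
      exact abs_sub _ _
    rw [mul_assoc]
    gcongr
    linarith

end Root

theorem leftover_regular : ∀ k l : ℕ, Regular (leftover k l) := by
  have base : ∀ k : ℕ, Regular fun a b : ℝ => a - k * b := by
    intro k
    refine ⟨fun b h => by simpa using h, fun a b b' h => by gcongr,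
      1 + k, by positivity, fun a b a' b' => ?_⟩
    rw [show a - k * b - (a' - k * b') = (a - a') - k * (b - b') by ring]
    refine (abs_sub _ _).trans ?_
    rw [abs_mul, abs_of_nonneg (Nat.cast_nonneg k : (0 : ℝ) ≤ k)]
    nlinarith [abs_nonneg (a - a'), abs_nonneg (b - b'),
      mul_nonneg (Nat.cast_nonneg k : (0 : ℝ) ≤ k) (abs_nonneg (a - a'))]
  intro k l
  induction hn : k + l generalizing k l with
  | zero =>
    obtain ⟨rfl, rfl⟩ : k = 0 ∧ l = 0 := by omega
    convert base 0 using 3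
    simp [leftover_zero]
  | succ n ih =>
    match k, l with
    | 0, l =>
      convert base 0 using 3
      simp [leftover_zero]
    | k + 1, 0 =>
      convert base (k + 1) using 3
      simp [leftover_succ_zero]
    | k + 1, l + 1 =>
      have := regular_step (ih k (l + 1) (by omega)) (ih (k + 1) l (by omega)) l k
      convert this using 3
      rw [leftover_succ]; rfl

/-! ### The price as the larger of the floor and the opponent's indifference point. -/

theorem le_price (k l : ℕ) (a b : ℝ) : b - a * (l + 1) / (k + 1) ≤ price k l a b :=
  le_max_left _ _

/-- At the price, the opponent does not strictly prefer winning. -/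
theorem price_excess_nonneg (k l : ℕ) (a b : ℝ) :
    (l + 1) * leftover k (l + 1) (a - price k l a b) b ≤
      price k l a b + l * leftover (k + 1) l a (b - price k l a b) := by
  have h1 : rootPrice (leftover k (l + 1)) (leftover (k + 1) l) l a b ≤ price k l a b :=
    le_max_right _ _
  have h2 := excess_growth (leftover_regular k (l + 1)) (leftover_regular (k + 1) l) l a b h1
  have h3 := rootPrice_spec (leftover_regular k (l + 1)) (leftover_regular (k + 1) l) l a b
  linarith

theorem price_excess_pos {k l : ℕ} {a b q : ℝ} (h : price k l a b < q) :
    (l + 1) * leftover k (l + 1) (a - q) b < q + l * leftover (k + 1) l a (b - q) := by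
  have h1 := excess_growth (leftover_regular k (l + 1)) (leftover_regular (k + 1) l) l a b h.le
  have h2 := price_excess_nonneg k l a b
  linarith

/-- Above its lowest possible value, the price makes the opponent indifferent. -/
theorem price_excess_eq {k l : ℕ} {a b : ℝ} (h : b - a * (l + 1) / (k + 1) < price k l a b) :
    price k l a b + l * leftover (k + 1) l a (b - price k l a b) =
      (l + 1) * leftover k (l + 1) (a - price k l a b) b := by
  have h1 : price k l a b = rootPrice (leftover k (l + 1)) (leftover (k + 1) l) l a b := by
    rcases max_choice (b - a * (l + 1) / (k + 1))
      (rootPrice (leftover k (l + 1)) (leftover (k + 1) l) l a b) with h1 | h1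
    · exact absurd h1 h.ne'
    · exact h1
  rw [h1]
  exact rootPrice_spec (leftover_regular k (l + 1)) (leftover_regular (k + 1) l) l a b

theorem price_le {k l : ℕ} {a b q : ℝ} (h : b - a * (l + 1) / (k + 1) ≤ q)
    (hq : (l + 1) * leftover k (l + 1) (a - q) b ≤ q + l * leftover (k + 1) l a (b - q)) :
    price k l a b ≤ q :=
  max_le h (rootPrice_le (leftover_regular k (l + 1)) (leftover_regular (k + 1) l) l hq)

theorem price_lt {k l : ℕ} {a b q : ℝ} (h : b - a * (l + 1) / (k + 1) < q)
    (hq : (l + 1) * leftover k (l + 1) (a - q) b < q + l * leftover (k + 1) l a (b - q)) :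
    price k l a b < q := by
  refine (price_le h.le hq.le).lt_of_ne fun heq => ?_
  subst heq
  linarith [price_excess_eq h]

theorem le_price_of_excess {k l : ℕ} {a b q : ℝ}
    (hq : q + l * leftover (k + 1) l a (b - q) ≤ (l + 1) * leftover k (l + 1) (a - q) b) :
    q ≤ price k l a b :=
  (le_rootPrice (leftover_regular k (l + 1)) (leftover_regular (k + 1) l) l hq).trans
    (le_max_right _ _)

/-- On the lower boundary of the cell the floor equals `s`, both continuations stay on such a
boundary, and the first agent spends `s` on each item until nothing is left. -/
theorem leftover_boundary (k l : ℕ) {s : ℝ} (hs : 0 ≤ s) :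
    leftover k l (s * k) (s * (l + 1)) = 0 := by
  induction hn : k + l generalizing k l with
  | zero =>
    obtain ⟨rfl, rfl⟩ : k = 0 ∧ l = 0 := by omega
    simp [leftover_zero]
  | succ n ih =>
    match k, l with
    | 0, l => simp [leftover_zero]
    | k + 1, 0 => simp [leftover_succ_zero]; ring
    | k + 1, l + 1 =>
      have h1 := ih k (l + 1) (by omega)
      have h2 := ih (k + 1) l (by omega)
      push_cast at h1 h2 ⊢
      have e1 : s * (k + 1) - s = s * k := by ring
      have e2 : s * ((l : ℝ) + 1 + 1) - s = s * (l + 1) := by ring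
      have e3 : s * ((l : ℝ) + 1 + 1) - s * (k + 1) * (l + 1) / (k + 1) = s := by
        field_simp; ring
      have hp : price k l (s * (k + 1)) (s * (l + 1 + 1)) = s := by
        refine le_antisymm (price_le e3.le ?_) (e3.symm.le.trans (le_price _ _ _ _))
        rw [e1, e2, h1, h2]; simpa using hs
      rw [leftover_succ, hp, e1, h1]

/-- On the middle line both continuations at price `s` are again on middle lines with leftover `s`,
so the opponent is indifferent at `s`. This line is the reference for most later estimates. -/
theorem leftover_mid (k l : ℕ) {s : ℝ} (hs : 0 ≤ s) :
    leftover k l (s * (k + 1)) (s * (l + 1)) = s := by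
  induction hn : k + l generalizing k l with
  | zero =>
    obtain ⟨rfl, rfl⟩ : k = 0 ∧ l = 0 := by omega
    simp [leftover_zero]
  | succ n ih =>
    match k, l with
    | 0, l => simp [leftover_zero]
    | k + 1, 0 => simp [leftover_succ_zero]; ring
    | k + 1, l + 1 =>
      have h1 := ih k (l + 1) (by omega)
      have h2 := ih (k + 1) l (by omega)
      push_cast at h1 h2 ⊢
      have e1 : s * (k + 1 + 1) - s = s * (k + 1) := by ring
      have e2 : s * ((l : ℝ) + 1 + 1) - s = s * (l + 1) := by ring
      have e3 : s * ((l : ℝ) + 1 + 1) - s * (k + 1 + 1) * (l + 1) / (k + 1) ≤ s := by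
        have : s * ((k : ℝ) + 1) * (l + 1) / (k + 1) ≤ s * (k + 1 + 1) * (l + 1) / (k + 1) := by
          gcongr; linarith
        rw [show s * ((k : ℝ) + 1) * (l + 1) / (k + 1) = s * (l + 1) by field_simp] at this
        linarith
      have hp : price k l (s * (k + 1 + 1)) (s * (l + 1 + 1)) = s := by
        refine le_antisymm (price_le e3 ?_) (le_price_of_excess ?_) <;>
        · rw [e1, e2, h1, h2]; exact le_of_eq (by ring)
      rw [leftover_succ, hp, e1, h1]

/-! ### Bounds on the leftover by comparison with the boundary and the middle line. -/

section Bounds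

variable {k l : ℕ} {a b : ℝ}

/-- Fix one budget and move the other until the point lies on the boundary line, where the leftover
is known, then use monotonicity. The other bounds of this section arise in the same way, from the
boundary or from the middle line. -/
theorem leftover_nonneg (hb : 0 ≤ b) (h : k * b ≤ (l + 1) * a) : 0 ≤ leftover k l a b := by
  have h1 := leftover_boundary k l (s := b / (l + 1)) (by positivity)
  rw [div_mul_cancel₀ _ (by positivity)] at h1
  rw [← h1]
  refine (leftover_regular k l).mono_le _ ?_
  rw [div_mul_eq_mul_div, div_le_iff₀ (by positivity)]
  linarith

theorem leftover_pos (hb : 0 ≤ b) (h : k * b < (l + 1) * a) : 0 < leftover k l a b := by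
  have h1 := leftover_boundary k l (s := b / (l + 1)) (by positivity)
  rw [div_mul_cancel₀ _ (by positivity)] at h1
  rw [← h1]
  refine (leftover_regular k l).mono _ ?_
  rw [div_mul_eq_mul_div, div_lt_iff₀ (by positivity)]
  linarith

theorem leftover_eq_zero (hb : 0 ≤ b) (h : k * b = (l + 1) * a) : leftover k l a b = 0 := by
  have h1 := leftover_boundary k l (s := b / (l + 1)) (by positivity)
  rw [div_mul_cancel₀ _ (by positivity)] at h1
  rw [← h1]
  congr 1
  rw [div_mul_eq_mul_div, eq_div_iff (by positivity)]
  linarith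

theorem leftover_le_left (ha : 0 ≤ a) (h : (l + 1) * a ≤ (k + 1) * b) :
    (k + 1) * leftover k l a b ≤ a := by
  have h1 := leftover_mid k l (s := a / (k + 1)) (by positivity)
  rw [div_mul_cancel₀ _ (by positivity)] at h1
  have h2 : leftover k l a b ≤ a / (k + 1) := by
    rw [← h1]
    refine (leftover_regular k l).anti _ ?_
    rw [div_mul_eq_mul_div, div_le_iff₀ (by positivity)]
    linarith
  rwa [le_div_iff₀' (by positivity)] at h2

theorem leftover_le_right (hb : 0 ≤ b) (h : (l + 1) * a ≤ (k + 1) * b) :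
    (l + 1) * leftover k l a b ≤ b := by
  have h1 := leftover_mid k l (s := b / (l + 1)) (by positivity)
  rw [div_mul_cancel₀ _ (by positivity)] at h1
  have h2 : leftover k l a b ≤ b / (l + 1) := by
    rw [← h1]
    refine (leftover_regular k l).mono_le _ ?_
    rw [div_mul_eq_mul_div, le_div_iff₀ (by positivity)]
    linarith
  rwa [le_div_iff₀' (by positivity)] at h2

theorem right_le_leftover (hb : 0 ≤ b) (h : (k + 1) * b ≤ (l + 1) * a) :
    b ≤ (l + 1) * leftover k l a b := by
  have h1 := leftover_mid k l (s := b / (l + 1)) (by positivity)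
  rw [div_mul_cancel₀ _ (by positivity)] at h1
  rw [← div_le_iff₀' (by positivity)]
  conv_lhs => rw [← h1]
  refine (leftover_regular k l).mono_le _ ?_
  rw [div_mul_eq_mul_div, div_le_iff₀ (by positivity)]
  linarith

theorem right_lt_leftover (hb : 0 ≤ b) (h : (k + 1) * b < (l + 1) * a) :
    b < (l + 1) * leftover k l a b := by
  have h1 := leftover_mid k l (s := b / (l + 1)) (by positivity)
  rw [div_mul_cancel₀ _ (by positivity)] at h1
  rw [← div_lt_iff₀' (by positivity)]
  conv_lhs => rw [← h1]
  refine (leftover_regular k l).mono _ ?_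
  rw [div_mul_eq_mul_div, div_lt_iff₀ (by positivity)]
  linarith

end Bounds

/-! ### Position of the budgets after the first item. -/

/-- The budgets `a` and `b` are such that the first agent wins the first `k` items, and the second
agent the other `l` items. -/
structure LowerHalf (k l : ℕ) (a b : ℝ) : Prop where
  pos : 0 < b
  cell : k * b < (l + 1) * a
  half : (l + 1) * a ≤ (k + 1) * b

theorem LowerHalf.pos_left {k l : ℕ} {a b : ℝ} (h : LowerHalf k l a b) : 0 < a := by
  have h1 := h.cell
  have h2 : 0 ≤ (k : ℝ) * b := mul_nonneg (Nat.cast_nonneg k) h.pos.le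
  exact pos_of_mul_pos_right (h2.trans_lt h1) (by positivity)

section Price

variable {k l : ℕ} {a b : ℝ}

/-- The lower bound on the price, without division. -/
theorem le_price' (k l : ℕ) (a b : ℝ) : (k + 1) * (b - price k l a b) ≤ (l + 1) * a := by
  have h := le_price k l a b
  have : a * ((l : ℝ) + 1) / (k + 1) * (k + 1) = a * (l + 1) := by field_simp
  nlinarith

theorem floor_lt_price (h : (k + 1) * (b - price k l a b) < (l + 1) * a) :
    b - a * (l + 1) / (k + 1) < price k l a b := by
  have : a * ((l : ℝ) + 1) / (k + 1) * (k + 1) = a * (l + 1) := by field_simp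
  by_contra hc
  nlinarith

/-- If the budgets crossed the middle line, the price would be below b/(l+2) and T above b/(l+2),
while Y ≤ b/(l+2) in any case. Then p + l Y < (l+1) T, against `price_excess_nonneg`. -/
theorem price_lost_half (h : LowerHalf (k + 1) (l + 1) a b) :
    (l + 2) * (a - price k l a b) ≤ (k + 1) * b := by
  obtain ⟨hb, hc, hh⟩ := h
  push_cast at hc hh
  by_contra hcon
  rw [not_le] at hcon
  set p := price k l a b
  have hp : (l + 2) * p < b := by linarith
  have hT := right_lt_leftover (k := k) (l := l + 1) (a := a - p) hb.le
    (by push_cast; linarith)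
  push_cast at hT
  have hF := price_excess_nonneg k l a b
  change (l + 1) * leftover k (l + 1) (a - p) b ≤ p + l * leftover (k + 1) l a (b - p) at hF
  have hY := leftover_le_right (k := k + 1) (l := l) (a := a) (b := b - p)
    (by nlinarith [Nat.cast_nonneg (α := ℝ) l]) (by push_cast; nlinarith)
  have hY2 : (l + 2) * leftover (k + 1) l a (b - p) ≤ b := by
    have h3 := leftover_le_left (k := k + 1) (l := l) (a := a) (b := b - p)
      (by nlinarith [Nat.cast_nonneg (α := ℝ) l, Nat.cast_nonneg (α := ℝ) k])
      (by push_cast; nlinarith)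
    push_cast at h3
    have : ((k : ℝ) + 2) * ((l + 2) * leftover (k + 1) l a (b - p)) ≤ (k + 2) * b := by
      nlinarith [Nat.cast_nonneg (α := ℝ) l]
    exact le_of_mul_le_mul_left this (by positivity)
  have h4 : (l : ℝ) * ((l + 2) * leftover (k + 1) l a (b - p)) ≤ l * b := by gcongr
  nlinarith [Nat.cast_nonneg (α := ℝ) l]

theorem price_lost_cell (h : LowerHalf (k + 1) (l + 1) a b) :
    k * b < (l + 2) * (a - price k l a b) := by
  have ha := h.pos_left
  obtain ⟨hb, hc, hh⟩ := h
  push_cast at hc hh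
  -- This price would take the first agent exactly to the lower boundary, where her leftover
  -- vanishes. The opponent then strictly prefers losing at `q`, so the actual price is smaller.
  set q : ℝ := a - k * b / (l + 2) with hq
  have hq' : (l + 2) * q = (l + 2) * a - k * b := by rw [hq]; field_simp
  have hbq : b < (l + 2) * q := by linarith
  have hq0 : 0 < q := pos_of_mul_pos_right (hb.trans hbq) (by positivity)
  have hYc : (k + 1) * (b - q) < (l + 1) * a := by
    have : ((l : ℝ) + 2) * ((k + 1) * (b - q)) < (l + 2) * ((l + 1) * a) := by
      have e : ((l : ℝ) + 2) * ((k + 1) * (b - q)) =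
        (k + 1) * ((l + 2) * b - (l + 2) * q) := by ring
      rw [e, hq']
      nlinarith [mul_pos (show (0 : ℝ) < k + l + 2 by positivity) (sub_pos.mpr hc)]
    exact lt_of_mul_lt_mul_left this (by positivity)
  have hX := leftover_eq_zero (k := k) (l := l + 1) (a := a - q) hb.le
    (by push_cast; rw [hq]; field_simp; ring)
  have hlt : price k l a b < q := by
    refine price_lt ?_ ?_
    · have : a * ((l : ℝ) + 1) / (k + 1) * (k + 1) = a * (l + 1) := by field_simp
      by_contra hc
      nlinarith
    · rw [hX]
      have hY : 0 ≤ leftover (k + 1) l a (b - q) := by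
        rcases le_total 0 (b - q) with h0 | h0
        · exact leftover_nonneg h0 (by push_cast; linarith)
        · refine (leftover_nonneg le_rfl ?_).trans ((leftover_regular (k + 1) l).anti a h0)
          simp; positivity
      have := mul_nonneg (Nat.cast_nonneg (α := ℝ) l) hY
      linarith
  nlinarith [Nat.cast_nonneg (α := ℝ) l]

/-- If the budgets crossed the middle line, the price would exceed b/(l+2) and lie above the floor,
so the opponent would be indifferent. But T ≤ b/(l+2) and Y ≥ (b-p)/(l+1) make p + l Y larger than
(l+1) T. -/
theorem price_won_half (h : LowerHalf (k + 1) (l + 1) a b) :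
    (l + 1) * a ≤ (k + 2) * (b - price k l a b) := by
  have hX := price_lost_half h
  have ha := h.pos_left
  obtain ⟨hb, hc, hh⟩ := h
  push_cast at hc hh
  set p := price k l a b with hp
  by_contra hcon
  rw [not_le] at hcon
  have hbp : b < (l + 2) * p := by
    have : ((k : ℝ) + 2) * b < (k + 2) * ((l + 2) * p) := by
      nlinarith [Nat.cast_nonneg (α := ℝ) l]
    exact lt_of_mul_lt_mul_left this (by positivity)
  have hF := price_excess_eq (k := k) (l := l) (a := a) (b := b) (floor_lt_price (by
    rw [← hp]
    rcases le_total 0 (b - p) with h0 | h0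
    · nlinarith
    · nlinarith [mul_nonneg (show (0 : ℝ) ≤ k + 1 by positivity) (neg_nonneg.mpr (show b - p ≤ 0 from h0)),
        mul_pos (show (0 : ℝ) < l + 1 by positivity) ha]))
  rw [← hp] at hF
  have hT := leftover_le_right (k := k) (l := l + 1) (a := a - p) hb.le (by push_cast; linarith)
  push_cast at hT
  have hY : b - p ≤ (l + 1) * leftover (k + 1) l a (b - p) := by
    rcases le_total 0 (b - p) with h0 | h0
    · exact right_le_leftover h0 (by push_cast; linarith)
    · have : 0 ≤ leftover (k + 1) l a (b - p) := by
        refine (leftover_nonneg le_rfl ?_).trans ((leftover_regular (k + 1) l).anti a h0)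
        simp; positivity
      nlinarith [mul_nonneg (show (0 : ℝ) ≤ l + 1 by positivity) this]
  set T := leftover k (l + 1) (a - p) b
  set Y := leftover (k + 1) l a (b - p)
  have h5 : (l : ℝ) * (b - p) ≤ l * ((l + 1) * Y) := by gcongr
  have h6 : ((l : ℝ) + 1) ^ 2 * (b - (l + 2) * T) ≥ 0 := mul_nonneg (by positivity) (by linarith)
  nlinarith [Nat.cast_nonneg (α := ℝ) l]

end Price

/-! ### The first agent is at least as eager to win as her opponent. -/

section Price

variable {k l : ℕ} {a b : ℝ}

/-- If the first agent wins the first item, she still is the one to win first. -/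
theorem LowerHalf.lose (h : LowerHalf (k + 1) (l + 1) a b) :
    LowerHalf k (l + 1) (a - price k l a b) b :=
  ⟨h.pos, by push_cast; linarith [price_lost_cell h], by push_cast; linarith [price_lost_half h]⟩

theorem LowerHalf.price_lt_right (h : LowerHalf (k + 1) (l + 1) a b) : price k l a b < b := by
  have h1 := price_won_half h
  have h2 : 0 < (k + 2) * (b - price k l a b) :=
    (mul_pos (by positivity) h.pos_left).trans_le h1
  linarith [pos_of_mul_pos_right h2 (by positivity)]

/-- The same if the second agent wins the first item, unless the price is the lowest possible. -/
theorem LowerHalf.win (h : LowerHalf (k + 1) (l + 1) a b)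
    (hp : (k + 1) * (b - price k l a b) < (l + 1) * a) :
    LowerHalf (k + 1) l a (b - price k l a b) :=
  ⟨by linarith [h.price_lt_right], by push_cast; linarith,
    by push_cast; linarith [price_won_half h]⟩

theorem LowerHalf.leftover_pos {k l : ℕ} {a b : ℝ} (h : LowerHalf k l a b) :
    0 < leftover k l a b :=
  _root_.leftover_pos h.pos.le h.cell

theorem won_eq_zero (h : LowerHalf (k + 1) (l + 1) a b)
    (hp : ¬ (k + 1) * (b - price k l a b) < (l + 1) * a) :
    leftover (k + 1) l a (b - price k l a b) = 0 :=
  leftover_eq_zero (by linarith [h.price_lt_right])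
    (by push_cast; linarith [le_price' k l a b])

theorem LowerHalf.win_of_pos (h : LowerHalf (k + 1) (l + 1) a b)
    (hY : 0 < leftover (k + 1) l a (b - price k l a b)) :
    (k + 1) * (b - price k l a b) < (l + 1) * a := by
  by_contra hc
  exact hY.ne' (won_eq_zero h hc)

/-- A price that is at most the final leftover budget is followed by a price above the lowest
possible one. -/
theorem next_price_above_floor {k l : ℕ} {a b : ℝ} (h : LowerHalf (k + 2) (l + 1) a b)
    (hl : 0 < l) (hp : price (k + 1) l a b ≤ leftover (k + 2) (l + 1) a b) :
    (k + 1) * (b - price k l (a - price (k + 1) l a b) b) <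
      (l + 1) * (a - price (k + 1) l a b) := by
  have hX : LowerHalf (k + 1) (l + 1) (a - price (k + 1) l a b) b := h.lose
  have hfl := le_price' (k + 1) l a b
  push_cast at hfl
  rw [leftover_succ] at hp
  have hT := hX.leftover_pos
  have hTb := leftover_le_right hX.pos.le hX.half
  push_cast at hTb
  -- At the floor the won leftover is zero, so the excess inequality reads (l+1) T ≤ r for the next
  -- price r. The two floor relations give b + (k+1) r ≤ (k+l+3) p, which contradicts b ≥ (l+2) T
  -- and p ≤ T because l > 0.
  by_contra hc
  have hY := won_eq_zero hX hc
  have hF := price_excess_nonneg k l (a - price (k + 1) l a b) b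
  rw [hY, ← leftover_succ] at hF
  set p := price (k + 1) l a b
  set r := price k l (a - p) b
  set T := leftover (k + 1) (l + 1) (a - p) b
  have hl' : (1 : ℝ) ≤ l := by exact_mod_cast hl
  have h1 : ((k : ℝ) + 1) * ((l + 1) * T) ≤ (k + 1) * r := by gcongr; linarith
  have h2 : (k + l + 3 : ℝ) * p ≤ (k + l + 3) * T := by gcongr
  nlinarith [mul_nonneg (Nat.cast_nonneg (α := ℝ) k) (mul_nonneg (Nat.cast_nonneg (α := ℝ) l) hT.le),
    mul_pos (show (0 : ℝ) < l by linarith) hT]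

/-- Every price of the first phase is at least the leftover budget. -/
theorem leftover_le_price {k l : ℕ} {a b : ℝ} (h : LowerHalf (k + 1) (l + 1) a b) :
    leftover (k + 1) (l + 1) a b ≤ price k l a b := by
  induction hn : k + l generalizing k l a b with
  | zero =>
    obtain ⟨rfl, rfl⟩ : k = 0 ∧ l = 0 := by omega
    have := price_excess_nonneg 0 0 a b
    rw [leftover_succ]; simpa using this
  | succ n ih =>
    -- Suppose p < T. The excess inequality forces Y > T if l > 0 and is already violated if l = 0.
    -- The main case compares two orders of the next two items: the opponent wins at p and then the
    -- first agent at q, or the first agent wins at p and then the opponent at r. Induction gives T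
    -- ≤ r and Y ≤ q, so p is below both q and r, and the second order leaves the first agent at
    -- least as much, Y ≤ Y'. Indifference in the next round, r + (l+1) Y' = (l+2) T, is then
    -- impossible.
    by_contra hcon
    rw [not_le] at hcon
    have hF := price_excess_nonneg k l a b
    rw [← leftover_succ] at hF
    match k, l with
    | k, 0 => simp only [CharP.cast_eq_zero, zero_mul, zero_add, one_mul, add_zero] at hF; linarith
    | k, l + 1 =>
      have hTY : leftover (k + 1) (l + 1 + 1) a b < leftover (k + 1) (l + 1) a
          (b - price k (l + 1) a b) := by
        push_cast at hF
        have : ((l : ℝ) + 1) * leftover (k + 1) (l + 1 + 1) a b <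
          (l + 1) * leftover (k + 1) (l + 1) a (b - price k (l + 1) a b) := by linarith
        exact lt_of_mul_lt_mul_left this (by positivity)
      have hT := h.leftover_pos
      have hY := h.win (h.win_of_pos (hT.trans hTY))
      match k with
      | 0 =>
        have h1 := leftover_le_left hY.pos_left.le hY.half
        rw [leftover_succ, leftover_zero] at hTY hcon
        push_cast at h1
        linarith
      | k + 1 =>
        have hX := h.lose
        have h1 := ih hX (by omega)
        have h2 := ih hY (by omega)
        have h3 := price_excess_eq (floor_lt_price (k := k) (l := l + 1)
          (a := a - price (k + 1) (l + 1) a b) (b := b) (by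
          have := next_price_above_floor h (by omega) hcon.le
          push_cast at this ⊢; exact this))
        rw [← leftover_succ, ← leftover_succ] at h3
        rw [← leftover_succ] at h1
        rw [leftover_succ (k + 1) l] at h2 hTY
        set p := price (k + 1) (l + 1) a b
        set r := price k (l + 1) (a - p) b
        set q := price (k + 1) l a (b - p)
        set T := leftover (k + 1 + 1) (l + 1 + 1) a b
        have h4 : leftover (k + 1) (l + 1) (a - q) (b - p) ≤ leftover (k + 1) (l + 1) (a - p) (b - r) :=
          ((leftover_regular _ _).mono_le _ (by linarith)).trans
            ((leftover_regular _ _).anti _ (by linarith))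
        push_cast at h3
        have h5 : ((l : ℝ) + 1) * T < (l + 1) * leftover (k + 1) (l + 1) (a - p) (b - r) := by
          gcongr; linarith
        linarith

/-- The first agent does not prefer losing at the price. -/
theorem won_le_lost (h : LowerHalf (k + 1) (l + 1 + 1) a b) :
    leftover (k + 1) (l + 1) a (b - price k (l + 1) a b) ≤ leftover (k + 1) (l + 1 + 1) a b := by
  by_cases hp : (k + 1) * (b - price k (l + 1) a b) < ((l + 1 : ℕ) + 1) * a
  · have h1 := price_excess_eq (floor_lt_price hp)
    rw [← leftover_succ] at h1
    have h2 := leftover_le_price h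
    push_cast at h1
    have : ((l : ℝ) + 1) * leftover (k + 1) (l + 1) a (b - price k (l + 1) a b) ≤
      (l + 1) * leftover (k + 1) (l + 1 + 1) a b := by linarith
    exact le_of_mul_le_mul_left this (by positivity)
  · rw [won_eq_zero h hp]
    exact h.leftover_pos.le

/-- When the opponent is to get a single item, the indifference equation p = T does not involve Y.
The explicit value Y = a - (k+1)(b - p), the bound (k+2) p ≤ a and strict distance from the middle
line give Y < T directly. -/
theorem won_lt_lost (h : LowerHalf (k + 1) 1 a b) (hs : 2 * a < (k + 2) * b) :
    leftover (k + 1) 0 a (b - price k 0 a b) < leftover (k + 1) 1 a b := by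
  by_cases hp : (k + 1) * (b - price k 0 a b) < ((0 : ℕ) + 1) * a
  · have h1 := price_excess_eq (floor_lt_price hp)
    rw [← leftover_succ] at h1
    simp only [CharP.cast_eq_zero, zero_mul, zero_add, one_mul, add_zero] at h1
    have h2 := leftover_le_left h.lose.pos_left.le h.lose.half
    rw [← leftover_succ, zero_add, ← h1] at h2
    rw [leftover_succ_zero, ← h1]
    set p := price k 0 a b
    have : ((k : ℝ) + 2) * (a - (k + 1) * (b - p)) < (k + 2) * p := by
      nlinarith [mul_le_mul_of_nonneg_left h2 (Nat.cast_nonneg (α := ℝ) k),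
        mul_lt_mul_of_pos_left hs (show (0 : ℝ) < k + 1 by positivity)]
    exact lt_of_mul_lt_mul_left this (by positivity)
  · rw [won_eq_zero h hp]
    exact h.leftover_pos

/-- If both agents are indifferent at the same price, then this price is the leftover budget, and
all further prices in the first phase are the same. -/
theorem leftover_of_won_eq_lost {k l : ℕ} {a b : ℝ} (h : LowerHalf (k + 1) (l + 1 + 1) a b)
    (heq : leftover (k + 1) (l + 1) a (b - price k (l + 1) a b) =
      leftover (k + 1) (l + 1 + 1) a b) :
    (k + 2) * leftover (k + 1) (l + 1 + 1) a b = a := by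
  induction k generalizing a b with
  | zero =>
    have hp := h.win_of_pos (heq ▸ h.leftover_pos)
    have h1 := price_excess_eq (floor_lt_price hp)
    rw [heq, ← leftover_succ] at h1
    push_cast at h1
    rw [leftover_succ, leftover_zero] at h1 ⊢
    push_cast
    linarith
  | succ k ih =>
    have hp := h.win_of_pos (heq ▸ h.leftover_pos)
    have h1 := price_excess_eq (floor_lt_price hp)
    rw [heq, ← leftover_succ] at h1
    have hpT : price (k + 1) (l + 1) a b = leftover (k + 1 + 1) (l + 1 + 1) a b := by
      push_cast at h1; linarith
    have h2 := leftover_le_price h.lose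
    have h3 := leftover_le_price (h.win hp)
    rw [heq] at h3
    have h4 := price_excess_eq (floor_lt_price (k := k) (l := l + 1)
          (a := a - price (k + 1) (l + 1) a b) (b := b) (by
      have := next_price_above_floor h (by omega) hpT.le
      push_cast at this ⊢; exact this))
    rw [leftover_succ (k + 1) l] at heq
    rw [← leftover_succ, ← leftover_succ] at h4
    rw [← leftover_succ] at h2
    -- The exchange of the next two items from `leftover_le_price` is used again, now with p = T.
    -- The resulting inequalities must all be equalities, so the next price is T as well and the
    -- next round satisfies the same hypothesis.
    have hih := ih h.lose
    rw [← leftover_succ] at hih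
    set p := price (k + 1) (l + 1) a b
    set r := price k (l + 1) (a - p) b
    set q := price (k + 1) l a (b - p)
    set T := leftover (k + 1 + 1) (l + 1 + 1) a b
    have h5 : leftover (k + 1) (l + 1) (a - q) (b - p) ≤ leftover (k + 1) (l + 1) (a - p) (b - r) :=
      ((leftover_regular _ _).mono_le _ (by linarith)).trans
        ((leftover_regular _ _).anti _ (by linarith))
    rw [heq] at h5
    push_cast at h4
    have h6 : ((l : ℝ) + 1) * T ≤ (l + 1) * leftover (k + 1) (l + 1) (a - p) (b - r) := by
      gcongr
    have h7 : r = T := by linarith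
    have h8 : ((l : ℝ) + 1) * T = (l + 1) * leftover (k + 1) (l + 1) (a - p) (b - r) := by
      linarith
    have h9 := hih (mul_left_cancel₀ (by positivity) h8).symm
    push_cast
    linarith

/-- If the leftover budget is an equal share of the budget, then it is the price. -/
theorem price_of_equal_share (h : LowerHalf (k + 1) (l + 1) a b)
    (hs : (k + 2) * leftover (k + 1) (l + 1) a b = a) :
    price k l a b = leftover (k + 1) (l + 1) a b := by
  have h1 := leftover_le_price h
  have h2 := leftover_le_left h.lose.pos_left.le h.lose.half
  rw [← leftover_succ] at h2
  linarith

/-- Converse of `leftover_of_won_eq_lost`: equal shares force p = T, and indifference then gives Y =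
T. At the floor, Y = 0 would give (l+2) T ≤ T, which is impossible. -/
theorem won_of_equal_share (h : LowerHalf (k + 1) (l + 1 + 1) a b)
    (hs : (k + 2) * leftover (k + 1) (l + 1 + 1) a b = a) :
    leftover (k + 1) (l + 1) a (b - price k (l + 1) a b) = leftover (k + 1) (l + 1 + 1) a b := by
  have h1 := price_of_equal_share h hs
  have hT := h.leftover_pos
  by_cases hp : (k + 1) * (b - price k (l + 1) a b) < ((l + 1 : ℕ) + 1) * a
  · have h2 := price_excess_eq (floor_lt_price hp)
    rw [← leftover_succ] at h2
    push_cast at h2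
    have : ((l : ℝ) + 1) * leftover (k + 1) (l + 1) a (b - price k (l + 1) a b) =
      (l + 1) * leftover (k + 1) (l + 1 + 1) a b := by linarith
    exact mul_left_cancel₀ (by positivity) this
  · have h2 := price_excess_nonneg k (l + 1) a b
    rw [won_eq_zero h hp, ← leftover_succ] at h2
    push_cast at h2
    nlinarith [mul_nonneg (Nat.cast_nonneg (α := ℝ) l) hT.le]

/-- Landing exactly on the middle line would give T ≥ b/(l+2), hence also p ≥ b/(l+2), and the
budgets would not have been strictly below the middle line before. -/
theorem LowerHalf.lose_strict (h : LowerHalf (k + 1) (l + 1) a b)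
    (hs : (l + 2) * a < (k + 2) * b) : (l + 2) * (a - price k l a b) < (k + 1) * b := by
  refine (price_lost_half h).lt_of_ne fun heq => ?_
  have h1 := leftover_le_price h
  rw [leftover_succ] at h1
  have h2 := right_le_leftover (k := k) (l := l + 1) (a := a - price k l a b) h.pos.le
    (by push_cast; linarith)
  push_cast at h2
  nlinarith [Nat.cast_nonneg (α := ℝ) l]

theorem LowerHalf.win_strict (h : LowerHalf (k + 1) (l + 1) a b)
    (hs : (l + 2) * a < (k + 2) * b) : (l + 1) * a < (k + 2) * (b - price k l a b) := by
  refine (price_won_half h).lt_of_ne fun heq => ?_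
  have hbp := h.price_lt_right
  have ha := h.pos_left
  have h1 := price_excess_eq (floor_lt_price (k := k) (l := l) (a := a) (b := b) (by nlinarith))
  have h2 := right_le_leftover (k := k + 1) (l := l) (a := a) (b := b - price k l a b)
    (by linarith) (by push_cast; linarith)
  have h3 := leftover_le_right h.lose.pos.le h.lose.half
  push_cast at h3
  set p := price k l a b
  set T := leftover k (l + 1) (a - p) b
  set Y := leftover (k + 1) l a (b - p)
  have hbp : b < (l + 2) * p := by
    have : ((k : ℝ) + 2) * b < (k + 2) * ((l + 2) * p) := by nlinarith
    exact lt_of_mul_lt_mul_left this (by positivity)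
  have h5 : (l : ℝ) * (b - p) ≤ l * ((l + 1) * Y) := by gcongr
  have h6 : ((l : ℝ) + 1) ^ 2 * (b - (l + 2) * T) ≥ 0 := mul_nonneg (by positivity) (by linarith)
  nlinarith [Nat.cast_nonneg (α := ℝ) l]

end Price

/-- Close to the middle of the cell, the leftover budget is an equal share of the budget. -/
theorem leftover_near_mid {k l : ℕ} (hl : 0 < l) {s e : ℝ} (hs : 0 ≤ s) (he : 0 ≤ e)
    (h : k * e ≤ s) : leftover k l ((k + 1) * s) ((l + 1) * s + e) = s := by
  induction hn : k + l generalizing k l with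
  | zero => omega
  | succ n ih =>
    match k, l with
    | 0, l => simp [leftover_zero]
    | k + 1, 0 => omega
    | k + 1, l + 1 =>
      push_cast at h ⊢
      have h1 := ih (k := k) (l := l + 1) (by omega) (by linarith) (by omega)
      push_cast at h1
      have e1 : ((k : ℝ) + 1 + 1) * s - s = (k + 1) * s := by ring
      have e2 : ((l : ℝ) + 1 + 1) * s + e - s = (l + 1) * s + e := by ring
      -- The factor `l` stays because the induction hypothesis fails for l = 0, where the leftover
      -- also depends on `e`; there the opponent's indifference does not involve Y anyway.
      have h2 : (l : ℝ) * leftover (k + 1) l ((k + 1 + 1) * s) ((l + 1) * s + e) = l * s := by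
        rcases Nat.eq_zero_or_pos l with rfl | hl
        · simp
        · have h2 := ih (k := k + 1) (l := l) hl (by push_cast; linarith) (by omega)
          push_cast at h2
          rw [h2]
      have e3 : ((l : ℝ) + 1 + 1) * s + e - (k + 1 + 1) * s * (l + 1) / (k + 1) ≤ s := by
        have : ((k : ℝ) + 1 + 1) * s * (l + 1) / (k + 1) * (k + 1) = (k + 1 + 1) * s * (l + 1) := by
          field_simp
        by_contra hc
        nlinarith [mul_nonneg (Nat.cast_nonneg (α := ℝ) l) hs]
      have hp : price k l ((k + 1 + 1) * s) ((l + 1 + 1) * s + e) = s := by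
        refine le_antisymm (price_le e3 ?_) (le_price_of_excess ?_) <;>
        · rw [e1, e2, h1, h2]; exact le_of_eq (by ring)
      rw [leftover_succ, hp, e1, h1]

/-! ### The budget that either agent has left -/

/-- The budget that an agent with budget `x` has left when she wins `k` items, and her opponent with
budget `y` wins `l` items. -/
noncomputable def remaining (k l : ℕ) (x y : ℝ) : ℝ :=
  if (l + 1) * x ≤ (k + 1) * y then leftover k l x y else x - k * leftover l k y x

/-- The budgets `x` and `y` are such that the agents certainly win `k` and `l` items. -/
structure InCell (k l : ℕ) (x y : ℝ) : Prop where
  left_nonneg : 0 ≤ x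
  right_nonneg : 0 ≤ y
  lower : k = 0 ∨ k * y < (l + 1) * x
  upper : l = 0 ∨ l * x < (k + 1) * y

theorem InCell.symm {k l : ℕ} {x y : ℝ} (h : InCell k l x y) : InCell l k y x :=
  ⟨h.right_nonneg, h.left_nonneg, h.upper, h.lower⟩

theorem LowerHalf.inCell {k l : ℕ} {a b : ℝ} (h : LowerHalf k l a b) : InCell k l a b :=
  ⟨h.pos_left.le, h.pos.le, Or.inr h.cell, Or.inr (by nlinarith [h.half, h.pos_left])⟩

section Remaining

variable {k l : ℕ} {x y x' y' : ℝ}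

theorem remaining_lower (h : (l + 1) * x ≤ (k + 1) * y) :
    remaining k l x y = leftover k l x y :=
  if_pos h

/-- The formulas for the agent who wins first and for the one who wins second agree on the middle
line, so each of them is valid on its closed half. -/
theorem remaining_upper (hy : 0 ≤ y) (h : (k + 1) * y ≤ (l + 1) * x) :
    remaining k l x y = x - k * leftover l k y x := by
  unfold remaining
  split_ifs with h1
  · have heq : (k + 1) * y = (l + 1) * x := le_antisymm h h1
    have h2 := leftover_mid k l (s := y / (l + 1)) (by positivity)
    have h3 := leftover_mid l k (s := y / (l + 1)) (by positivity)
    have e1 : y / ((l : ℝ) + 1) * (k + 1) = x := by field_simp; linarith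
    have e2 : y / ((l : ℝ) + 1) * (l + 1) = y := by field_simp
    rw [e1, e2] at h2 h3
    rw [h2, h3]
    linarith
  · rfl

theorem remaining_zero (l : ℕ) (x y : ℝ) : remaining 0 l x y = x := by
  unfold remaining
  split_ifs <;> simp [leftover_zero]

theorem remaining_right_zero (k : ℕ) (x y : ℝ) : remaining k 0 x y = x - k * y := by
  unfold remaining
  split_ifs <;> simp [leftover_zero, leftover_right_zero]

theorem remaining_mid (k l : ℕ) {s : ℝ} (hs : 0 ≤ s) :
    remaining k l (s * (k + 1)) (s * (l + 1)) = s := by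
  rw [remaining_lower (by linarith), leftover_mid k l hs]

theorem remaining_lower_le (hx : 0 ≤ x) (h : (l + 1) * x ≤ (k + 1) * y) :
    (k + 1) * remaining k l x y ≤ x := by
  rw [remaining_lower h]
  exact leftover_le_left hx h

theorem remaining_upper_ge (hx : 0 ≤ x) (h : (k + 1) * y < (l + 1) * x) :
    x ≤ (k + 1) * remaining k l x y := by
  rw [remaining, if_neg (not_le.mpr h)]
  have h1 := leftover_le_right hx h.le
  nlinarith [mul_le_mul_of_nonneg_left h1 (Nat.cast_nonneg (α := ℝ) k)]

/-- Within a half this is regularity of `leftover`. Across the middle line, the remaining budget is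
at most x/(k+1) below it and at least x/(k+1) above it; the change of budgets considered never
crosses downwards. -/
theorem remaining_mono (hx : 0 ≤ x) (hxx : x ≤ x') (hyy : y' ≤ y) :
    remaining k l x y ≤ remaining k l x' y' := by
  by_cases h1 : (l + 1) * x ≤ (k + 1) * y <;> by_cases h2 : (l + 1) * x' ≤ (k + 1) * y'
  · rw [remaining_lower h1, remaining_lower h2]
    exact ((leftover_regular k l).mono_le _ hxx).trans ((leftover_regular k l).anti _ hyy)
  · have h3 := remaining_lower_le hx h1
    have h4 := remaining_upper_ge (hx.trans hxx) (not_le.mp h2)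
    exact le_of_mul_le_mul_left (h3.trans (hxx.trans h4)) (by positivity)
  · exact absurd ((mul_le_mul_of_nonneg_left hxx (by positivity)).trans
      (h2.trans (mul_le_mul_of_nonneg_left hyy (by positivity)))) h1
  · rw [remaining, if_neg h1, remaining, if_neg h2]
    have h3 : leftover l k y' x' ≤ leftover l k y x :=
      ((leftover_regular l k).mono_le _ hyy).trans ((leftover_regular l k).anti _ hxx)
    have := mul_le_mul_of_nonneg_left h3 (Nat.cast_nonneg (α := ℝ) k)
    linarith

theorem remaining_strictMono (hx : 0 ≤ x) (hxx : x < x') (hyy : y' ≤ y) :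
    remaining k l x y < remaining k l x' y' := by
  by_cases h1 : (l + 1) * x ≤ (k + 1) * y <;> by_cases h2 : (l + 1) * x' ≤ (k + 1) * y'
  · rw [remaining_lower h1, remaining_lower h2]
    exact ((leftover_regular k l).mono _ hxx).trans_le ((leftover_regular k l).anti _ hyy)
  · have h3 := remaining_lower_le hx h1
    have h4 := remaining_upper_ge (hx.trans hxx.le) (not_le.mp h2)
    exact lt_of_mul_lt_mul_left (h3.trans_lt (hxx.trans_le h4)) (by positivity)
  · exact absurd ((mul_le_mul_of_nonneg_left hxx.le (by positivity)).trans
      (h2.trans (mul_le_mul_of_nonneg_left hyy (by positivity)))) h1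
  · rw [remaining, if_neg h1, remaining, if_neg h2]
    have h3 : leftover l k y' x' ≤ leftover l k y x :=
      ((leftover_regular l k).mono_le _ hyy).trans ((leftover_regular l k).anti _ hxx.le)
    have := mul_le_mul_of_nonneg_left h3 (Nat.cast_nonneg (α := ℝ) k)
    linarith

theorem InCell.remaining_nonneg (h : InCell k l x y) : 0 ≤ remaining k l x y := by
  by_cases h1 : (l + 1) * x ≤ (k + 1) * y
  · rw [remaining_lower h1]
    refine leftover_nonneg h.right_nonneg ?_
    rcases h.lower with rfl | h2
    · have := h.left_nonneg
      simp; positivity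
    · exact h2.le
  · have h2 := remaining_upper_ge h.left_nonneg (not_le.mp h1)
    exact nonneg_of_mul_nonneg_right (h.left_nonneg.trans h2) (by positivity)

theorem InCell.remaining_pos (h : InCell k l x y) (hx : 0 < x) : 0 < remaining k l x y := by
  by_cases h1 : (l + 1) * x ≤ (k + 1) * y
  · rw [remaining_lower h1]
    refine leftover_pos h.right_nonneg ?_
    rcases h.lower with rfl | h2
    · simp; positivity
    · exact h2
  · have h2 := remaining_upper_ge h.left_nonneg (not_le.mp h1)
    exact pos_of_mul_pos_right (hx.trans_le h2) (by positivity)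

theorem InCell.remaining_le (h : InCell k l x y) : remaining k l x y ≤ x := by
  by_cases h1 : (l + 1) * x ≤ (k + 1) * y
  · have h2 := remaining_lower_le h.left_nonneg h1
    nlinarith [mul_nonneg (Nat.cast_nonneg (α := ℝ) k) h.remaining_nonneg]
  · rw [remaining, if_neg h1]
    have h2 : 0 ≤ leftover l k y x := by
      refine leftover_nonneg h.left_nonneg ?_
      rcases h.upper with rfl | h2
      · have := h.right_nonneg
        simp; positivity
      · exact h2.le
    have := mul_nonneg (Nat.cast_nonneg (α := ℝ) k) h2
    linarith

theorem InCell.mid (k l : ℕ) {s : ℝ} (hs : 0 < s) :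
    InCell k l (s * (k + 1)) (s * (l + 1)) :=
  ⟨by positivity, by positivity, Or.inr (by nlinarith [mul_pos hs (show (0 : ℝ) < l + 1 by positivity)]),
    Or.inr (by nlinarith [mul_pos hs (show (0 : ℝ) < k + 1 by positivity)])⟩

end Remaining

/-- Every pair of budgets lies in a cell or on a boundary between two cells. -/
theorem exists_inCell_or_boundary (m : ℕ) {x y : ℝ} (hx : 0 ≤ x) (hy : 0 ≤ y)
    (h : 0 < x ∨ 0 < y) :
    (∃ k l, k + l = m ∧ InCell k l x y) ∨
      ∃ k l, k + 1 + l = m ∧ 0 < x ∧ ((k : ℝ) + 1) * y = (l + 1) * x := by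
  have hxy : 0 < x + y := by rcases h with h | h <;> linarith
  -- The number `n` is the integer part of (m+1) x/(x+y). Its two bounds are, for n ≤ m, the weak
  -- lower and the strict upper condition of the cell (n, m - n); equality in the lower one is the
  -- boundary. The case n > m occurs only for y = 0.
  obtain ⟨n, h1, h2⟩ : ∃ n : ℕ, n * (x + y) ≤ (m + 1) * x ∧ (m + 1) * x < (n + 1) * (x + y) := by
    refine ⟨⌊(m + 1) * x / (x + y)⌋₊, ?_, ?_⟩
    · rw [← le_div_iff₀ hxy]; exact Nat.floor_le (by positivity)
    · rw [← div_lt_iff₀ hxy]; exact Nat.lt_floor_add_one _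
  rcases le_or_gt n m with hnm | hnm
  · obtain ⟨l, rfl⟩ := Nat.exists_eq_add_of_le hnm
    push_cast at h1 h2
    rcases Nat.eq_zero_or_pos n with h0 | h0
    · rw [h0] at h2
      refine Or.inl ⟨0, l, by omega, hx, hy, Or.inl rfl, Or.inr ?_⟩
      push_cast at h2 ⊢
      linarith
    · rcases (show (n : ℝ) * y ≤ (l + 1) * x by linarith).lt_or_eq with h3 | h3
      · exact Or.inl ⟨n, l, rfl, hx, hy, Or.inr h3, Or.inr (by linarith)⟩
      · obtain ⟨k, hk⟩ := Nat.exists_eq_add_of_lt h0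
        refine Or.inr ⟨k, l, by omega, ?_, ?_⟩
        · by_contra hc
          have hx0 : x = 0 := le_antisymm (not_lt.mp hc) hx
          rw [hx0, mul_zero] at h3
          have : (0 : ℝ) < n := by exact_mod_cast h0
          have : y = 0 := by
            rcases mul_eq_zero.mp h3 with h4 | h4 <;> linarith
          linarith
        · rw [hk] at h3
          push_cast at h3
          linarith
  · refine Or.inl ⟨m, 0, rfl, hx, hy, Or.inr ?_, Or.inl rfl⟩
    have h3 : (m + 1 : ℝ) ≤ n := by exact_mod_cast hnm
    have h4 : (m + 1) * (x + y) ≤ n * (x + y) := by gcongr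
    have h5 : (m + 1) * y ≤ 0 := by linarith
    have h6 : y = 0 := le_antisymm (by by_contra hc; nlinarith [Nat.cast_nonneg (α := ℝ) m]) hy
    rw [h6] at hxy ⊢
    simp
    linarith

/-! ### Two agents -/

/-- The function that takes the value `x` at agent `i` and the value `y` at the opponent. -/
def pair {α : Type*} (i : Agent) (x y : α) : Agent → α := fun j => if j = i then x else y

theorem opp_opp (i : Agent) : opp (opp i) = i := by fin_cases i <;> rfl

theorem opp_ne (i : Agent) : opp i ≠ i := by fin_cases i <;> decide

theorem eq_or_eq_opp (i j : Agent) : j = i ∨ j = opp i := by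
  fin_cases i <;> fin_cases j <;> simp [opp]

theorem pair_self {α : Type*} (i : Agent) (x y : α) : pair i x y i = x := if_pos rfl

theorem pair_of_opp {α : Type*} (i : Agent) (x y : α) : pair i x y (opp i) = y :=
  if_neg (opp_ne i)

theorem pair_opp {α : Type*} (i : Agent) (x y : α) : pair (opp i) x y = pair i y x := by
  funext j
  rcases eq_or_eq_opp i j with rfl | rfl
  · have := pair_of_opp (opp j) x y
    rw [opp_opp] at this
    rw [this, pair_self]
  · rw [pair_self, pair_of_opp]

theorem pair_eta {α : Type*} (i : Agent) (b : Agent → α) : pair i (b i) (b (opp i)) = b := by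
  funext j
  rcases eq_or_eq_opp i j with rfl | rfl
  · rw [pair_self]
  · rw [pair_of_opp]

theorem pay_pair (i : Agent) (x y p : ℝ) : pay (pair i x y) i p = pair i (max (x - p) 0) y := by
  funext j
  rcases eq_or_eq_opp i j with rfl | rfl
  · simp [pay, pair_self]
  · simp [pay, pair_of_opp, opp_ne]

theorem pay_pair_opp (i : Agent) (x y p : ℝ) :
    pay (pair i x y) (opp i) p = pair i x (max (y - p) 0) := by
  rw [← pair_opp, pay_pair, pair_opp]

/-- The expected utility of agent `i` with budget `x`, when her opponent has budget `y`. -/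
noncomputable def util (v : Agent → ℝ) (m : ℕ) (i : Agent) (x y : ℝ) : ℝ :=
  canonUtil v m (pair i x y) i

/-- The critical price of agent `i` with budget `x`, when her opponent has budget `y`. -/
noncomputable def crit (v : Agent → ℝ) (m : ℕ) (i : Agent) (x y : ℝ) : ℝ :=
  critPrice v (canonUtil v m) (pair i x y) i

theorem crit_def (v : Agent → ℝ) (m : ℕ) (i : Agent) (x y : ℝ) :
    crit v m i x y = sSup {p : ℝ | 0 ≤ p ∧ p ≤ x ∧
      util v m i x (max (y - p) 0) < v i + util v m i (max (x - p) 0) y} := by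
  unfold crit critPrice loseUtil winUtil util
  simp only [pay_pair, pay_pair_opp, pair_self]

theorem canonBid_pair (v : Agent → ℝ) (m : ℕ) (i : Agent) (x y : ℝ) :
    canonBid v m (pair i x y) i = ⟨min (crit v m i x y) (crit v m (opp i) y x),
      decide (crit v m (opp i) y x < crit v m i x y)⟩ := by
  unfold canonBid bidGiven crit
  rw [pair_opp]

theorem canonBid_pair_opp (v : Agent → ℝ) (m : ℕ) (i : Agent) (x y : ℝ) :
    canonBid v m (pair i x y) (opp i) = ⟨min (crit v m i x y) (crit v m (opp i) y x),
      decide (crit v m i x y < crit v m (opp i) y x)⟩ := by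
  rw [← pair_opp, canonBid_pair, opp_opp, min_comm]

theorem not_beats_iff (v : Agent → ℝ) (m : ℕ) (i : Agent) (x y : ℝ) :
    ¬ (canonBid v m (pair i x y) (opp i)).Beats (canonBid v m (pair i x y) i) ↔
      crit v m (opp i) y x ≤ crit v m i x y := by
  rw [canonBid_pair, canonBid_pair_opp]
  simp only [Bid.Beats, lt_self_iff_false, true_and, false_or, decide_eq_true_eq,
    decide_eq_false_iff_not, not_and, not_lt]
  exact ⟨fun h => by by_contra hc; exact hc (h (not_le.mp hc).le), fun h _ => h⟩

theorem beats_iff (v : Agent → ℝ) (m : ℕ) (i : Agent) (x y : ℝ) :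
    (canonBid v m (pair i x y) (opp i)).Beats (canonBid v m (pair i x y) i) ↔
      crit v m i x y < crit v m (opp i) y x := by
  rw [← not_iff_not, not_beats_iff, not_lt]

theorem beats_iff' (v : Agent → ℝ) (m : ℕ) (i : Agent) (x y : ℝ) :
    (canonBid v m (pair i x y) i).Beats (canonBid v m (pair i x y) (opp i)) ↔
      crit v m (opp i) y x < crit v m i x y := by
  have := beats_iff v m (opp i) y x
  rwa [pair_opp, opp_opp] at this

theorem util_zero (v : Agent → ℝ) (i : Agent) (x y : ℝ) : util v 0 i x y = x := by
  simp [util, canonUtil, pair_self]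

theorem util_succ (v : Agent → ℝ) (m : ℕ) (i : Agent) (x y : ℝ) :
    util v (m + 1) i x y =
      winProb (canonBid v m (pair i x y) i) (canonBid v m (pair i x y) (opp i)) *
        (v i + util v m i (max (x - min (crit v m i x y) (crit v m (opp i) y x)) 0) y) +
      winProb (canonBid v m (pair i x y) (opp i)) (canonBid v m (pair i x y) i) *
        util v m i x (max (y - min (crit v m i x y) (crit v m (opp i) y x)) 0) := by
  have h1 : (canonBid v m (pair i x y) i).amount =
    min (crit v m i x y) (crit v m (opp i) y x) := by rw [canonBid_pair]
  have h2 : (canonBid v m (pair i x y) (opp i)).amount =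
    min (crit v m i x y) (crit v m (opp i) y x) := by rw [canonBid_pair_opp]
  conv_lhs => rw [util, canonUtil]
  change winProb (canonBid v m (pair i x y) i) (canonBid v m (pair i x y) (opp i)) *
    winUtil v _ _ i (canonBid v m (pair i x y) i).amount +
      winProb (canonBid v m (pair i x y) (opp i)) (canonBid v m (pair i x y) i) *
        loseUtil _ _ i (canonBid v m (pair i x y) (opp i)).amount = _
  rw [h1, h2, winUtil, loseUtil, pay_pair, pay_pair_opp]
  rfl

theorem util_succ_tie {v : Agent → ℝ} {m : ℕ} {i : Agent} {x y p : ℝ}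
    (h1 : crit v m i x y = p) (h2 : crit v m (opp i) y x = p) :
    util v (m + 1) i x y = 1 / 2 * (v i + util v m i (max (x - p) 0) y) +
      1 / 2 * util v m i x (max (y - p) 0) := by
  rw [util_succ, winProb, winProb, if_neg, if_neg, if_neg, if_neg, h1, h2, min_self] <;>
    simp [beats_iff, beats_iff', h1, h2]

/-- If all possible winners of the first item lead to the same utility, then it is the expected
utility. -/
theorem util_succ_eq {v : Agent → ℝ} {m : ℕ} {i : Agent} {x y u : ℝ}
    (hwin : crit v m (opp i) y x ≤ crit v m i x y →
      v i + util v m i (max (x - crit v m (opp i) y x) 0) y = u)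
    (hlose : crit v m i x y ≤ crit v m (opp i) y x →
      util v m i x (max (y - crit v m i x y) 0) = u) :
    util v (m + 1) i x y = u := by
  rcases lt_trichotomy (crit v m i x y) (crit v m (opp i) y x) with h | h | h
  · rw [util_succ, winProb, winProb, if_neg, if_pos, if_pos, min_eq_left h.le, hlose h.le]
    · ring
    · simpa [beats_iff] using h
    · simpa [beats_iff] using h
    · simpa [beats_iff'] using h.le
  · rw [util_succ_tie h rfl, hwin h.ge, ← h, hlose h.le]
    ring
  · rw [util_succ, winProb, winProb, if_pos, if_neg, if_pos, min_eq_right h.le, hwin h.le]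
    · ring
    · simpa [beats_iff'] using h
    · simpa [beats_iff] using h.le
    · simpa [beats_iff'] using h

/-! ### Expected utilities and the critical prices that they determine. -/

/-- The items are worth much more than the budget `x`. -/
def Rich (v : Agent → ℝ) (m : ℕ) (x : ℝ) : Prop := ∀ j, 2 ^ m * x < v j

theorem Rich.mono {v : Agent → ℝ} {m : ℕ} {x x' : ℝ} (h : Rich v m x) (hx : x' ≤ x) :
    Rich v m x' := fun j =>
  (mul_le_mul_of_nonneg_left hx (by positivity)).trans_lt (h j)

theorem Rich.of_succ {v : Agent → ℝ} {m : ℕ} {x : ℝ} (h : Rich v (m + 1) x) (hx : 0 ≤ x) :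
    Rich v m x := fun j => by
  have h1 := h j
  rw [pow_succ] at h1
  have : 0 ≤ 2 ^ m * x := by positivity
  linarith

theorem Rich.lt {v : Agent → ℝ} {m : ℕ} {x : ℝ} (h : Rich v m x) (hx : 0 ≤ x) (j : Agent) :
    x < v j := by
  refine lt_of_le_of_lt ?_ (h j)
  exact le_mul_of_one_le_left hx (one_le_pow₀ (by norm_num))

theorem Rich.pos {v : Agent → ℝ} {m : ℕ} {x : ℝ} (h : Rich v m x) (hx : 0 ≤ x) (j : Agent) :
    0 < v j :=
  hx.trans_lt (h.lt hx j)

/-- The utilities with `m` items, inside the cells and on the boundaries between them. -/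
structure UtilSpec (v : Agent → ℝ) (m : ℕ) : Prop where
  cell : ∀ {i k l x y}, Rich v m x → Rich v m y → k + l = m → InCell k l x y →
    util v m i x y = v i * k + remaining k l x y
  boundary_ge : ∀ {i k l x y}, Rich v m x → Rich v m y → k + 1 + l = m → 0 < x →
    ((k : ℝ) + 1) * y = (l + 1) * x → v i * k + v i / 2 ^ m ≤ util v m i x y
  boundary_le : ∀ {i k l x y}, Rich v m x → Rich v m y → k + 1 + l = m → 0 < x →
    ((k : ℝ) + 1) * y = (l + 1) * x → util v m i x y ≤ v i * (k + 1)

section Spec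

variable {v : Agent → ℝ} {m : ℕ} {i : Agent} {x y x' y' p : ℝ}

theorem UtilSpec.cell_ge (H : UtilSpec v m) {k l : ℕ} (hx : Rich v m x) (hy : Rich v m y)
    (hm : k + l = m) (h : InCell k l x y) : v i * k ≤ util v m i x y := by
  rw [H.cell hx hy hm h]
  linarith [h.remaining_nonneg]

theorem UtilSpec.cell_le (H : UtilSpec v m) {k l : ℕ} (hx : Rich v m x) (hy : Rich v m y)
    (hm : k + l = m) (h : InCell k l x y) : util v m i x y ≤ v i * k + x := by
  rw [H.cell hx hy hm h]
  linarith [h.remaining_le]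

/-- The power of two in `Rich` is needed here: v/2^m exceeds the budget, so the chance of one more
item on a boundary outweighs any money in the cell with fewer items. -/
theorem UtilSpec.boundary_gt (H : UtilSpec v m) {k l : ℕ} (hx : Rich v m x) (hy : Rich v m y)
    (hm : k + 1 + l = m) (h0 : 0 < x) (h : ((k : ℝ) + 1) * y = (l + 1) * x) :
    v i * k + x < util v m i x y := by
  refine lt_of_lt_of_le ?_ (H.boundary_ge hx hy hm h0 h)
  have : x < v i / 2 ^ m := by
    rw [lt_div_iff₀ (by positivity), mul_comm]
    exact hx i
  linarith

/-- The utility is increasing in the own budget and decreasing in the opponent's. -/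
theorem UtilSpec.mono_aux (H : UtilSpec v m) (hx : 0 ≤ x) (hxx : x ≤ x') (hy : 0 ≤ y')
    (hyy : y' ≤ y) (h : 0 < x ∨ 0 < y) (h' : 0 < x' ∨ 0 < y')
    (hrx : Rich v m x') (hry : Rich v m y) :
    util v m i x y ≤ util v m i x' y' ∧ (x < x' → util v m i x y < util v m i x' y') := by
  have hv := hrx.lt (hx.trans hxx) i
  have hv0 := hrx.pos (hx.trans hxx) i
  have rx := hrx.mono hxx
  have ry := hry.mono hyy
  have step : ∀ {p q : ℕ}, p < q → v i * p + v i ≤ v i * q := by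
    intro p q hpq
    have : (p : ℝ) + 1 ≤ q := by exact_mod_cast hpq
    nlinarith
  have stepLE : ∀ {p q : ℕ}, p ≤ q → v i * p ≤ v i * q := by
    intro p q hpq
    have : (p : ℝ) ≤ q := by exact_mod_cast hpq
    gcongr
  have prodLE : ∀ {p q : ℕ} {s t : ℝ}, p ≤ q → 0 ≤ s → s ≤ t → (p : ℝ) * s ≤ q * t := by
    intro p q s t hpq hs hst
    have : (p : ℝ) ≤ q := by exact_mod_cast hpq
    gcongr
  -- If the two points lie in different cells or lines, the numbers of items decide, and the wrong
  -- order contradicts the inequalities. Inside one cell the remaining budget decides. On one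
  -- boundary line the two changes of budget are possible only if nothing changes.
  rcases exists_inCell_or_boundary m hx (hy.trans hyy) h with ⟨k, l, hm, hc⟩ | ⟨k, l, hm, h0, hb⟩ <;>
  rcases exists_inCell_or_boundary m (hx.trans hxx) hy h' with
    ⟨k', l', hm', hc'⟩ | ⟨k', l', hm', h0', hb'⟩
  · rcases lt_trichotomy k k' with hk | rfl | hk
    · have h1 := H.cell_le (i := i) rx hry hm hc
      have h2 := H.cell_ge (i := i) hrx ry hm' hc'
      have h3 := step hk
      exact ⟨by linarith, fun _ => by linarith⟩
    · obtain rfl : l = l' := by omega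
      rw [H.cell rx hry hm hc, H.cell hrx ry hm' hc']
      exact ⟨by linarith [remaining_mono (k := k) (l := l) hx hxx hyy], fun hlt => by
        linarith [remaining_strictMono (k := k) (l := l) hx hlt hyy]⟩
    · exfalso
      rcases hc.lower with h1 | h1
      · omega
      rcases hc'.upper with h2 | h2
      · omega
      have h3 := prodLE (show k' + 1 ≤ k by omega) hy hyy
      have h4 := prodLE (show l + 1 ≤ l' by omega) hx hxx
      push_cast at h3 h4
      linarith
  · rcases le_or_gt k k' with hk | hk
    · have h1 := H.cell_le (i := i) rx hry hm hc
      have h2 := H.boundary_gt (i := i) hrx ry hm' h0' hb'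
      have h3 := stepLE hk
      exact ⟨by linarith, fun _ => by linarith⟩
    · exfalso
      rcases hc.lower with h1 | h1
      · omega
      have h3 := prodLE (show k' + 1 ≤ k by omega) hy hyy
      have h4 := prodLE (show l + 1 ≤ l' + 1 by omega) hx hxx
      push_cast at h3 h4
      linarith
  · rcases lt_or_ge k k' with hk | hk
    · have h1 := H.boundary_le (i := i) rx hry hm h0 hb
      have h2 := H.cell hrx ry hm' hc' (i := i)
      have h3 := step hk
      have h4 := hc'.remaining_pos (h0.trans_le hxx)
      exact ⟨by linarith, fun _ => by linarith⟩
    · exfalso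
      rcases hc'.upper with h2 | h2
      · omega
      have h3 := prodLE (show k' + 1 ≤ k + 1 by omega) hy hyy
      have h4 := prodLE (show l + 1 ≤ l' by omega) hx hxx
      push_cast at h3 h4
      linarith
  · rcases lt_trichotomy k k' with hk | rfl | hk
    · have h1 := H.boundary_le (i := i) rx hry hm h0 hb
      have h2 := H.boundary_gt (i := i) hrx ry hm' h0' hb'
      have h3 := step hk
      exact ⟨by linarith, fun _ => by linarith⟩
    · obtain rfl : l = l' := by omega
      have h1 : ((l : ℝ) + 1) * x' ≤ (l + 1) * x := by
        rw [← hb, ← hb']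
        gcongr
      have h2 : x' = x := le_antisymm (le_of_mul_le_mul_left h1 (by positivity)) hxx
      subst h2
      have h3 : y' = y := mul_left_cancel₀ (show (k : ℝ) + 1 ≠ 0 by positivity) (hb'.trans hb.symm)
      subst h3
      exact ⟨le_rfl, fun hlt => absurd hlt (lt_irrefl _)⟩
    · exfalso
      have h3 := prodLE (show k' + 1 ≤ k + 1 by omega) hy hyy
      have h4 := prodLE (show l + 1 + 1 ≤ l' + 1 by omega) hx hxx
      push_cast at h3 h4
      linarith

theorem crit_nonneg : 0 ≤ crit v m i x y := by
  rw [crit_def]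
  exact Real.sSup_nonneg fun q hq => hq.1

theorem crit_le_budget (hx : 0 ≤ x) : crit v m i x y ≤ x := by
  rw [crit_def]
  exact Real.sSup_le (fun q hq => hq.2.1) hx

theorem le_crit_of_lt (hp : 0 ≤ p) (hpx : p ≤ x)
    (h : util v m i x (max (y - p) 0) < v i + util v m i (max (x - p) 0) y) :
    p ≤ crit v m i x y := by
  rw [crit_def]
  exact le_csSup ⟨x, fun q hq => hq.2.1⟩ ⟨hp, hpx, h⟩

/-- Weak preference at `p` suffices: the utility of winning falls strictly with the price, so
winning is strictly better at every smaller price. Together with `crit_le` this makes an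
indifference price the critical price. -/
theorem UtilSpec.le_crit (H : UtilSpec v m) (hy : 0 < y) (hpx : p ≤ x)
    (hrx : Rich v m x) (hry : Rich v m y)
    (h : util v m i x (max (y - p) 0) ≤ v i + util v m i (max (x - p) 0) y) :
    p ≤ crit v m i x y := by
  by_contra hc
  rw [not_le] at hc
  obtain ⟨q, hq1, hq2⟩ := exists_between hc
  have hq0 : 0 ≤ q := crit_nonneg.trans hq1.le
  refine absurd (le_crit_of_lt (i := i) hq0 (hq2.le.trans hpx) ?_) (not_le.mpr hq1)
  have h1 := (H.mono_aux (i := i) (x := max (x - p) 0) (x' := max (x - q) 0) (y := y) (y' := y)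
    (le_max_right _ _) (max_le_max (by linarith) le_rfl) hy.le le_rfl (Or.inr hy) (Or.inr hy)
    (hrx.mono (max_le (by linarith) (by linarith))) hry).2
    ((max_eq_left (sub_nonneg.mpr hpx)).trans_lt (lt_of_lt_of_le (by linarith) (le_max_left _ _)))
  have hx : 0 < x := by linarith
  have h2 := (H.mono_aux (i := i) (x := x) (x' := x) (y := max (y - q) 0) (y' := max (y - p) 0)
    hx.le le_rfl (le_max_right _ _) (max_le_max (by linarith) le_rfl) (Or.inl hx) (Or.inl hx)
    hrx (hry.mono (max_le (by linarith) hy.le))).1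
  linarith

theorem UtilSpec.crit_le (H : UtilSpec v m) (hy : 0 < y) (hp : 0 ≤ p)
    (hrx : Rich v m x) (hry : Rich v m y)
    (h : v i + util v m i (max (x - p) 0) y ≤ util v m i x (max (y - p) 0)) :
    crit v m i x y ≤ p := by
  rw [crit_def]
  refine Real.sSup_le ?_ hp
  rintro q ⟨hq0, hqx, hq⟩
  by_contra hc
  rw [not_le] at hc
  have hx : 0 < x := by linarith
  have h1 := (H.mono_aux (i := i) (x := max (x - q) 0) (x' := max (x - p) 0) (y := y) (y' := y)
    (le_max_right _ _) (max_le_max (by linarith) le_rfl) hy.le le_rfl (Or.inr hy) (Or.inr hy)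
    (hrx.mono (max_le (by linarith) (by linarith))) hry).1
  have h2 := (H.mono_aux (i := i) (x := x) (x' := x) (y := max (y - p) 0) (y' := max (y - q) 0)
    hx.le le_rfl (le_max_right _ _) (max_le_max (by linarith) le_rfl) (Or.inl hx) (Or.inl hx)
    hrx (hry.mono (max_le (by linarith) hy.le))).1
  linarith

/-- An agent who cannot win an item any more bids her whole budget, and is outbid. -/
theorem UtilSpec.crit_poor (H : UtilSpec v m) (hx : 0 ≤ x) (h : (m + 1) * x < y)
    (hrx : Rich v m x) (hry : Rich v m y) :
    crit v m i x y = x ∧ x < crit v m (opp i) y x := by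
  have hmx : 0 ≤ m * x := by positivity
  have hy : 0 < y := by linarith
  constructor
  · refine le_antisymm (crit_le_budget hx) (le_crit_of_lt hx le_rfl ?_)
    rw [sub_self, max_self, max_eq_left (by linarith)]
    have c1 : InCell 0 m x (y - x) := ⟨hx, by linarith, Or.inl rfl, Or.inr (by simp; linarith)⟩
    have c2 : InCell 0 m 0 y := ⟨le_rfl, hy.le, Or.inl rfl, Or.inr (by simpa using hy)⟩
    rw [H.cell hrx (hry.mono (by linarith)) (by simp) c1, H.cell (hrx.mono hx) hry (by simp) c2,
      remaining_zero, remaining_zero]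
    simpa using hrx.lt hx i
  · obtain ⟨q, hq1, hq2⟩ := exists_between (show x < y - m * x by linarith)
    refine hq1.trans_le (le_crit_of_lt (hx.trans hq1.le) (by linarith) ?_)
    rw [max_eq_right (by linarith), max_eq_left (by linarith)]
    have c1 : InCell m 0 y 0 := ⟨hy.le, le_rfl, Or.inr (by simpa using hy), Or.inl rfl⟩
    have c2 : InCell m 0 (y - q) x := ⟨by linarith, hx, Or.inr (by simp; linarith), Or.inl rfl⟩
    have h1 := H.cell_le (i := opp i) hry (hrx.mono hx) (by simp) c1
    have h2 := H.cell_ge (i := opp i) (hry.mono (by linarith)) hrx (by simp) c2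
    linarith [hry.lt hy.le (opp i)]

theorem remaining_of_opp_lower {k l : ℕ} (hx : 0 ≤ x) (h : (l + 1) * x ≤ (k + 1) * y) :
    remaining l k y x = y - l * leftover k l x y :=
  remaining_upper hx h

open Filter Topology in
/-- The critical prices in the lower half of a cell. -/
theorem UtilSpec.crit_lower (H : UtilSpec v m) {k l : ℕ} (hm : k + l + 1 = m)
    (h : LowerHalf (k + 1) (l + 1) x y) (hs : (l + 2) * x < (k + 2) * y)
    (hrx : Rich v m x) (hry : Rich v m y) :
    crit v m (opp i) y x = price k l x y ∧
    (leftover (k + 1) l x (y - price k l x y) < leftover (k + 1) (l + 1) x y →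
      price k l x y < crit v m i x y) ∧
    (leftover (k + 1) l x (y - price k l x y) = leftover (k + 1) (l + 1) x y →
      crit v m i x y = price k l x y) := by
  have hx := h.pos_left
  have hy := h.pos
  have hp := h.leftover_pos.trans_le (leftover_le_price h)
  have a1 := price_lost_cell h
  have a2 := h.lose_strict hs
  have a3 := le_price' k l x y
  have a4 := h.win_strict hs
  rw [leftover_succ]
  set p := price k l x y with hpdef
  -- the situation at prices close to `p`
  have near : ∀ᶠ q in 𝓝 p, 0 < q ∧ k * y < (l + 2) * (x - q) ∧ (l + 2) * (x - q) < (k + 1) * y ∧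
      (l + 1) * x < (k + 2) * (y - q) := by
    refine Filter.Eventually.and ?_ (Filter.Eventually.and ?_ (Filter.Eventually.and ?_ ?_))
    · exact lt_mem_nhds hp
    · exact ContinuousAt.eventually_lt (by fun_prop) (by fun_prop) a1
    · exact ContinuousAt.eventually_lt (by fun_prop) (by fun_prop) a2
    · exact ContinuousAt.eventually_lt (by fun_prop) (by fun_prop) a4
  have bx : ∀ {q : ℝ}, k * y < (l + 2) * (x - q) → 0 < x - q := fun hq =>
    pos_of_mul_pos_right (lt_of_le_of_lt (by positivity) hq) (by positivity)
  have by' : ∀ {q : ℝ}, (l + 1) * x < (k + 2) * (y - q) → 0 < y - q := fun hq =>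
    pos_of_mul_pos_right (lt_of_le_of_lt (by positivity) hq) (by positivity)
  have cX : ∀ {q : ℝ}, k * y < (l + 2) * (x - q) → (l + 2) * (x - q) < (k + 1) * y →
      InCell k (l + 1) (x - q) y := fun h1 h2 =>
    ⟨(bx h1).le, hy.le, Or.inr (by push_cast; linarith), Or.inr (by push_cast; linarith [bx h1])⟩
  have cY : ∀ {q : ℝ}, (k + 1) * (y - q) < (l + 1) * x → (l + 1) * x < (k + 2) * (y - q) →
      InCell (k + 1) l x (y - q) := fun h1 h2 =>
    ⟨hx.le, (by' h2).le, Or.inr (by push_cast; linarith), Or.inr (by push_cast; linarith)⟩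
  -- utilities
  have uX : ∀ {q : ℝ}, 0 < q → k * y < (l + 2) * (x - q) → (l + 2) * (x - q) < (k + 1) * y →
      util v m i (max (x - q) 0) y = v i * k + leftover k (l + 1) (x - q) y ∧
      util v m (opp i) y (max (x - q) 0) =
        v (opp i) * (l + 1) + (y - (l + 1) * leftover k (l + 1) (x - q) y) := by
    intro q hq h1 h2
    have hc := cX h1 h2
    rw [max_eq_left (bx h1).le, H.cell (hrx.mono (by linarith)) hry (by omega) hc,
      H.cell hry (hrx.mono (by linarith)) (by omega) hc.symm,
      remaining_lower (by push_cast; linarith),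
      remaining_of_opp_lower (bx h1).le (by push_cast; linarith)]
    push_cast
    exact ⟨rfl, rfl⟩
  have uY : ∀ {q : ℝ}, 0 < q → (k + 1) * (y - q) < (l + 1) * x →
      (l + 1) * x < (k + 2) * (y - q) →
      util v m i x (max (y - q) 0) = v i * (k + 1) + leftover (k + 1) l x (y - q) ∧
      util v m (opp i) (max (y - q) 0) x =
        v (opp i) * l + (y - q - l * leftover (k + 1) l x (y - q)) := by
    intro q hq h1 h2
    have hc := cY h1 h2
    rw [max_eq_left (by' h2).le, H.cell hrx (hry.mono (by linarith)) (by omega) hc,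
      H.cell (hry.mono (by linarith)) hrx (by omega) hc.symm,
      remaining_lower (by push_cast; linarith),
      remaining_of_opp_lower hx.le (by push_cast; linarith)]
    push_cast
    exact ⟨rfl, rfl⟩
  refine ⟨le_antisymm ?_ ?_, ?_, ?_⟩
  -- Just above the price the excess is positive, so the opponent is better off losing.
  · by_contra hc
    rw [not_le] at hc
    obtain ⟨q, ⟨h0, h1, h2, h3⟩, h4, h5⟩ :=
      ((near.filter_mono nhdsWithin_le_nhds).and (Ioo_mem_nhdsGT hc)).exists
    refine absurd (H.crit_le (i := opp i) hx h0.le hry hrx ?_) (not_le.mpr h5)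
    have hlow : (k + 1) * (y - q) < (l + 1) * x := by nlinarith [Nat.cast_nonneg (α := ℝ) k]
    rw [(uX h0 h1 h2).2, (uY h0 hlow h3).2]
    have := price_excess_pos (k := k) (l := l) (a := x) (b := y) (q := q) h4
    linarith
  -- Above the floor the opponent is indifferent at `p`. At the floor, a slightly smaller price
  -- would move (x, y - q) into the cell (k, l+1), where he wins one item more than by losing now.
  · by_cases hfl : (k + 1) * (y - p) < (l + 1) * x
    · refine H.le_crit (i := opp i) hx (by linarith [by' a4]) hry hrx ?_
      rw [(uX hp a1 a2).2, (uY hp hfl a4).2]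
      have := price_excess_eq (floor_lt_price hfl)
      rw [← hpdef] at this
      linarith
    · by_contra hc
      rw [not_le] at hc
      have near' : ∀ᶠ q in 𝓝 p, (k : ℝ) * (y - q) < (l + 2) * x := by
        refine ContinuousAt.eventually_lt (by fun_prop) (by fun_prop) ?_
        linarith [by' a4]
      obtain ⟨q, ⟨⟨h0, h1, h2, h3⟩, h6⟩, h4, h5⟩ :=
        (((near.and near').filter_mono nhdsWithin_le_nhds).and (Ioo_mem_nhdsLT hc)).exists
      refine absurd (le_crit_of_lt (i := opp i) h0.le (by linarith [by' h3]) ?_) (not_le.mpr h4)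
      have c1 : InCell k (l + 1) x (y - q) :=
        ⟨hx.le, (by' h3).le, Or.inr (by push_cast; linarith), Or.inr (by push_cast; nlinarith)⟩
      have g1 := H.cell_le (i := opp i) hry (hrx.mono (by linarith)) (by omega) (cX h1 h2).symm
      have g2 := H.cell_ge (i := opp i) (hry.mono (by linarith)) hrx (by omega) c1.symm
      rw [max_eq_left (bx h1).le, max_eq_left (by' h3).le]
      linarith [hry.lt hy.le (opp i)]
  · intro hlt
    -- The first agent's strict preference at `p` persists at slightly higher prices by continuity,
    -- so her critical price is strictly larger.
    have cont : ∀ᶠ q in 𝓝 p,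
        leftover (k + 1) l x (y - q) < leftover k (l + 1) (x - q) y := by
      refine ContinuousAt.eventually_lt (Continuous.continuousAt ?_) (Continuous.continuousAt ?_) hlt
      · exact (leftover_regular _ _).continuous.comp (f := fun q : ℝ => (x, y - q)) (by fun_prop)
      · exact (leftover_regular _ _).continuous.comp (f := fun q : ℝ => (x - q, y)) (by fun_prop)
    obtain ⟨q, ⟨⟨h0, h1, h2, h3⟩, h6⟩, h4⟩ :=
      (((near.and cont).filter_mono nhdsWithin_le_nhds).and
        (self_mem_nhdsWithin (s := Set.Ioi p))).exists
    have hpq : p < q := h4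
    refine hpq.trans_le (H.le_crit hy (by linarith [bx h1]) hrx hry ?_)
    rw [(uX h0 h1 h2).1, (uY h0 (by nlinarith [Nat.cast_nonneg (α := ℝ) k]) h3).1]
    linarith
  · intro heq
    have hfl := h.win_of_pos (by rw [← hpdef, heq, ← leftover_succ]; exact h.leftover_pos)
    rw [← hpdef] at hfl
    refine le_antisymm (H.crit_le hy hp.le hrx hry ?_)
      (H.le_crit hy (by linarith [bx a1]) hrx hry ?_)
    all_goals
      rw [(uX hp a1 a2).1, (uY hp hfl a4).1, heq]
      linarith

/-- The critical prices in the middle of a cell. -/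
theorem UtilSpec.crit_mid (H : UtilSpec v m) {k l : ℕ} (hm : k + l + 1 = m) {s : ℝ} (hs : 0 < s)
    (hrx : Rich v m (s * (k + 2))) (hry : Rich v m (s * (l + 2))) :
    crit v m i (s * (k + 2)) (s * (l + 2)) = s := by
  have e1 : s * ((k : ℝ) + 2) - s = s * (k + 1) := by ring
  have e2 : s * ((l : ℝ) + 2) - s = s * (l + 1) := by ring
  have r1 : Rich v m (s * ((k : ℝ) + 1)) := hrx.mono (by linarith)
  have r2 : Rich v m (s * ((l : ℝ) + 1)) := hry.mono (by linarith)
  have cX := InCell.mid k (l + 1) hs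
  have cY := InCell.mid (k + 1) l hs
  have mX := remaining_mid k (l + 1) hs.le
  have mY := remaining_mid (k + 1) l hs.le
  have f1 : ((k + 1 : ℕ) : ℝ) + 1 = k + 2 := by push_cast; ring
  have f2 : ((l + 1 : ℕ) : ℝ) + 1 = l + 2 := by push_cast; ring
  rw [f2] at cX mX
  rw [f1] at cY mY
  -- Both continuations lie on middle lines with the same leftover `s`, so the order of the wins
  -- makes no difference to the agent.
  have heq : v i + util v m i (max (s * (k + 2) - s) 0) (s * (l + 2)) =
      util v m i (s * (k + 2)) (max (s * (l + 2) - s) 0) := by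
    rw [e1, e2, max_eq_left (by positivity), max_eq_left (by positivity),
      H.cell r1 hry (by omega) cX, H.cell hrx r2 (by omega) cY, mX, mY]
    push_cast
    ring
  exact le_antisymm (H.crit_le (by positivity) hs.le hrx hry heq.le)
    (H.le_crit (by positivity) (by nlinarith [Nat.cast_nonneg (α := ℝ) k]) hrx hry heq.ge)

open Filter Topology in
/-- The critical prices on a boundary between two cells. -/
theorem UtilSpec.crit_boundary (H : UtilSpec v m) {k l : ℕ} (hm : k + l = m) {s : ℝ} (hs : 0 < s)
    (hrx : Rich v m (s * (k + 1))) (hry : Rich v m (s * (l + 1))) :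
    crit v m i (s * (k + 1)) (s * (l + 1)) = s := by
  set x := s * ((k : ℝ) + 1) with hxdef
  set y := s * ((l : ℝ) + 1) with hydef
  have hx : 0 < x := by positivity
  have hy : 0 < y := by positivity
  have hk := mul_nonneg hs.le (Nat.cast_nonneg (α := ℝ) k)
  have hl := mul_nonneg hs.le (Nat.cast_nonneg (α := ℝ) l)
  have hbal : ((l : ℝ) + 1) * x = (k + 1) * y := by rw [hxdef, hydef]; ring
  apply le_antisymm
  · match k with
    | 0 =>
      refine (crit_le_budget hx.le).trans (le_of_eq ?_)
      rw [hxdef]; simp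
    | k + 1 =>
      push_cast at hbal hxdef hk
      by_contra hc
      rw [not_le] at hc
      -- Above `s`, losing the item yields one item more in total, or, if l = 0, equally many and
      -- more money. The slack `s` keeps the second inequality strict for l = 0 and is absorbed by x
      -- ≥ s otherwise.
      have near : ∀ᶠ q in 𝓝 s, k * y < (l + 2) * (x - q) ∧ l * x < (k + 3) * (y - q) + s := by
        refine Filter.Eventually.and ?_ ?_
        · refine ContinuousAt.eventually_lt (by fun_prop) (by fun_prop) ?_
          rw [hxdef, hydef]
          nlinarith
        · refine ContinuousAt.eventually_lt (by fun_prop) (by fun_prop) ?_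
          rw [hxdef, hydef]
          nlinarith
      obtain ⟨q, ⟨h1, h2⟩, h3, h4⟩ :=
        ((near.filter_mono nhdsWithin_le_nhds).and (Ioo_mem_nhdsGT hc)).exists
      have hqx : 0 < x - q :=
        pos_of_mul_pos_right (lt_of_le_of_lt (by positivity) h1) (by positivity)
      refine absurd (H.crit_le hy (hs.trans h3).le hrx hry ?_) (not_le.mpr h4)
      have hcell : InCell k (l + 1) (x - q) y :=
        ⟨hqx.le, hy.le, Or.inr (by push_cast; linarith), Or.inr (by push_cast; nlinarith)⟩
      have hW := H.cell_le (i := i) (hrx.mono (by linarith)) hry (by omega) hcell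
      rw [max_eq_left hqx.le]
      match l with
      | 0 =>
        have c2 : InCell (k + 1) 0 x 0 := ⟨hx.le, le_rfl, Or.inr (by simpa using hx), Or.inl rfl⟩
        have hy' : y - q ≤ 0 := by rw [hydef]; push_cast; linarith
        rw [max_eq_right hy', H.cell hrx (hry.mono hy.le) (by omega) c2, remaining_right_zero]
        push_cast
        linarith
      | l + 1 =>
        push_cast at hbal h2 hydef
        have hqy : 0 ≤ y - q := by
          have h5 : 0 ≤ l * x := by positivity
          have h6 : 0 < (k + 3) * (y - q) := by linarith
          exact (pos_of_mul_pos_right h6 (by positivity)).le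
        have c2 : InCell (k + 2) l x (y - q) :=
          ⟨hx.le, hqy, Or.inr (by push_cast; nlinarith), Or.inr (by push_cast; nlinarith)⟩
        have hL := H.cell_ge (i := i) hrx (hry.mono (by linarith)) (by omega) c2
        rw [max_eq_left hqy]
        push_cast at hL
        linarith [hrx.lt hx.le i]
  -- Below `s`, both continuations lie in the cell (k, l), so winning is worth one item more.
  · by_contra hc
    rw [not_le] at hc
    obtain ⟨q, h1, h2⟩ := exists_between hc
    have h0 : 0 ≤ q := crit_nonneg.trans h1.le
    refine absurd (le_crit_of_lt h0 (by nlinarith) ?_) (not_le.mpr h1)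
    have hqx : 0 < x - q := by nlinarith
    have hqy : 0 < y - q := by nlinarith
    have hlq : (l : ℝ) * q ≤ l * s := by gcongr
    have hkq : (k : ℝ) * q ≤ k * s := by gcongr
    have c1 : InCell k l (x - q) y :=
      ⟨hqx.le, hy.le, Or.inr (by nlinarith), Or.inr (by nlinarith)⟩
    have c2 : InCell k l x (y - q) :=
      ⟨hx.le, hqy.le, Or.inr (by nlinarith), Or.inr (by nlinarith)⟩
    have g1 := H.cell_ge (i := i) (hrx.mono (by linarith)) hry hm c1
    have g2 := H.cell_le (i := i) hrx (hry.mono (by linarith)) hm c2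
    rw [max_eq_left hqx.le, max_eq_left hqy.le]
    linarith [hrx.lt hx.le i]

end Spec

/-! ### The induction step for the expected utilities. -/

section Outcome

variable {v : Agent → ℝ} {m : ℕ} {i : Agent} {x y : ℝ} {k l : ℕ}

/-- If agent `i` possibly wins the first item, then she still wins `k` items in total, and the
remaining budgets are as predicted. -/
def WinKeeps (v : Agent → ℝ) (m : ℕ) (i : Agent) (k l : ℕ) (x y : ℝ) : Prop :=
  crit v m (opp i) y x ≤ crit v m i x y →
    ∃ k', k = k' + 1 ∧ crit v m (opp i) y x ≤ x ∧ InCell k' l (x - crit v m (opp i) y x) y ∧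
      remaining k' l (x - crit v m (opp i) y x) y = remaining k l x y ∧
      remaining l k' y (x - crit v m (opp i) y x) = remaining l k y x

theorem UtilSpec.winKeeps_poor (H : UtilSpec v m) (h : InCell 0 (m + 1) x y)
    (hrx : Rich v m x) (hry : Rich v m y) :
    WinKeeps v m i 0 (m + 1) x y ∧ WinKeeps v m (opp i) (m + 1) 0 y x := by
  have hx := h.left_nonneg
  have hu : (m + 1) * x < y := by
    rcases h.upper with h1 | h1
    · omega
    · push_cast at h1; linarith
  obtain ⟨h1, h2⟩ := H.crit_poor (i := i) hx hu hrx hry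
  have hmx : 0 ≤ m * x := by positivity
  refine ⟨fun hw => absurd h2 (not_lt.mpr (hw.trans h1.le)), fun _ => ⟨m, rfl, ?_⟩⟩
  rw [opp_opp, h1]
  refine ⟨by linarith, ⟨by linarith, hx, Or.inr (by push_cast; linarith), Or.inl rfl⟩, ?_, ?_⟩
  · rw [remaining_right_zero, remaining_right_zero]; push_cast; ring
  · rw [remaining_zero, remaining_zero]

/-- A win of the first agent follows the recursion of `leftover`. The opponent can win only if the
critical prices agree, which forces Y = T; his indifference equation then preserves both remaining
budgets. -/
theorem UtilSpec.winKeeps_lower (H : UtilSpec v m) (hm : k + l + 1 = m)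
    (h : LowerHalf (k + 1) (l + 1) x y) (hs : (l + 2) * x < (k + 2) * y)
    (hrx : Rich v m x) (hry : Rich v m y) :
    WinKeeps v m i (k + 1) (l + 1) x y ∧ WinKeeps v m (opp i) (l + 1) (k + 1) y x := by
  obtain ⟨h1, h2, h3⟩ := H.crit_lower (i := i) hm h hs hrx hry
  have hX := h.lose
  have hXh := hX.half
  have hx' := hX.pos_left
  have hT : leftover (k + 1) (l + 1) x y = leftover k (l + 1) (x - price k l x y) y :=
    leftover_succ ..
  have hh : ((l + 1 : ℕ) + 1 : ℝ) * x ≤ ((k + 1 : ℕ) + 1) * y := h.half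
  constructor
  · intro _
    rw [h1]
    refine ⟨k, rfl, by linarith, hX.inCell, ?_, ?_⟩
    · rw [remaining_lower hh, remaining_lower hXh, hT]
    · rw [remaining_of_opp_lower h.pos_left.le hh, remaining_of_opp_lower hx'.le hXh, hT]
  · intro hw
    rw [opp_opp, h1] at hw
    have hle : leftover (k + 1) l x (y - price k l x y) ≤ leftover (k + 1) (l + 1) x y := by
      match l with
      | 0 => exact (won_lt_lost h (by push_cast at hs; linarith)).le
      | l + 1 => exact won_le_lost h
    have heq : leftover (k + 1) l x (y - price k l x y) = leftover (k + 1) (l + 1) x y :=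
      hle.antisymm (not_lt.mp fun hlt => absurd (h2 hlt) (not_lt.mpr hw))
    have hfl := h.win_of_pos (heq ▸ h.leftover_pos)
    have hY := h.win hfl
    have hF := price_excess_eq (floor_lt_price hfl)
    rw [heq, ← leftover_succ] at hF
    rw [opp_opp, h3 heq]
    refine ⟨l, rfl, by linarith [h.price_lt_right], hY.inCell.symm, ?_, ?_⟩
    · rw [remaining_of_opp_lower h.pos_left.le hh, remaining_of_opp_lower hY.pos_left.le hY.half,
        heq]
      push_cast
      linarith
    · rw [remaining_lower hh, remaining_lower hY.half, heq]

theorem UtilSpec.winKeeps_mid (H : UtilSpec v m) (hm : k + l + 1 = m) {s : ℝ} (hs : 0 < s)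
    (hrx : Rich v m (s * (k + 2))) (hry : Rich v m (s * (l + 2))) :
    WinKeeps v m i (k + 1) (l + 1) (s * (k + 2)) (s * (l + 2)) := by
  intro _
  rw [H.crit_mid (i := opp i) (k := l) (l := k) (by omega) hs hry hrx]
  have e1 : s * ((k : ℝ) + 2) - s = s * (k + 1) := by ring
  have f1 : s * ((k : ℝ) + 2) = s * ((k + 1 : ℕ) + 1) := by push_cast; ring
  have f2 : s * ((l : ℝ) + 2) = s * ((l + 1 : ℕ) + 1) := by push_cast; ring
  refine ⟨k, rfl, by nlinarith [Nat.cast_nonneg (α := ℝ) k], ?_⟩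
  rw [e1, f1, f2, remaining_mid _ _ hs.le, remaining_mid _ _ hs.le, remaining_mid _ _ hs.le,
    remaining_mid _ _ hs.le]
  exact ⟨InCell.mid _ _ hs, rfl, rfl⟩

theorem UtilSpec.winKeeps (H : UtilSpec v m) (hm : k + l = m + 1) (h : InCell k l x y)
    (hrx : Rich v m x) (hry : Rich v m y) :
    WinKeeps v m i k l x y ∧ WinKeeps v m (opp i) l k y x := by
  match k, l with
  | 0, l =>
    obtain rfl : l = m + 1 := by omega
    exact H.winKeeps_poor h hrx hry
  | k + 1, 0 =>
    obtain rfl : k = m := by omega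
    have := H.winKeeps_poor (i := opp i) h.symm hry hrx
    rw [opp_opp] at this
    exact this.symm
  | k + 1, l + 1 =>
    have hl : ((k + 1 : ℕ) : ℝ) * y < ((l + 1 : ℕ) + 1) * x := by
      rcases h.lower with h1 | h1
      · omega
      · exact h1
    have hu : ((l + 1 : ℕ) : ℝ) * x < ((k + 1 : ℕ) + 1) * y := by
      rcases h.upper with h1 | h1
      · omega
      · exact h1
    have hx := h.left_nonneg
    have hy := h.right_nonneg
    have hx0 : 0 < x := pos_of_mul_pos_right (lt_of_le_of_lt (by positivity) hl) (by positivity)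
    have hy0 : 0 < y := pos_of_mul_pos_right (lt_of_le_of_lt (by positivity) hu) (by positivity)
    push_cast at hl hu
    rcases lt_trichotomy (((l : ℝ) + 2) * x) ((k + 2) * y) with hs | hs | hs
    · exact H.winKeeps_lower (by omega)
        ⟨hy0, by push_cast; linarith, by push_cast; linarith⟩ hs hrx hry
    · have e1 : x = x / (k + 2) * (k + 2) := by field_simp
      have e2 : y = x / (k + 2) * (l + 2) := by field_simp; linarith
      have hs0 : 0 < x / (k + 2) := by positivity
      set s := x / (k + 2)
      rw [e1] at hrx ⊢
      rw [e2] at hry ⊢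
      exact ⟨H.winKeeps_mid (by omega) hs0 hrx hry, H.winKeeps_mid (by omega) hs0 hry hrx⟩
    · have := H.winKeeps_lower (i := opp i) (k := l) (l := k) (by omega)
        ⟨hx0, by push_cast; linarith, by push_cast; linarith⟩ hs hry hrx
      rw [opp_opp] at this
      exact this.symm

theorem utilSpec_zero (v : Agent → ℝ) : UtilSpec v 0 := by
  constructor
  · intro i k l x y _ _ hm _
    obtain ⟨rfl, rfl⟩ : k = 0 ∧ l = 0 := by omega
    simp [util_zero, remaining_zero]
  · intro i k l x y _ _ hm
    omega
  · intro i k l x y _ _ hm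
    omega

/-- Either result of the coin toss leads to a boundary with one item less, or to an end cell if an
agent runs out of money. Winning guarantees v k + v/2^m and losing v k, so averaging halves the
surplus. -/
theorem UtilSpec.boundary_succ (H : UtilSpec v m) (hm : k + l = m) {s : ℝ} (hs : 0 < s)
    (hrx : Rich v m (s * (k + 1))) (hry : Rich v m (s * (l + 1))) :
    v i * k + v i / 2 ^ (m + 1) ≤ util v (m + 1) i (s * (k + 1)) (s * (l + 1)) ∧
      util v (m + 1) i (s * (k + 1)) (s * (l + 1)) ≤ v i * (k + 1) := by
  rw [util_succ_tie (H.crit_boundary hm hs hrx hry)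
    (H.crit_boundary (by omega) hs hry hrx)]
  have e1 : s * ((k : ℝ) + 1) - s = s * k := by ring
  have e2 : s * ((l : ℝ) + 1) - s = s * l := by ring
  rw [e1, e2, max_eq_left (by positivity), max_eq_left (by positivity)]
  have hv := hrx.pos (by positivity) i
  have hv1 := hrx.lt (by positivity) i
  have rx : Rich v m (s * k) := hrx.mono (by linarith)
  have ry : Rich v m (s * l) := hry.mono (by linarith)
  have hpow : v i / 2 ^ (m + 1) = v i / 2 ^ m / 2 := by rw [pow_succ]; field_simp
  have hpow1 : v i / 2 ^ m ≤ v i := div_le_self hv.le (one_le_pow₀ (by norm_num))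
  have hpow0 : 0 ≤ v i / 2 ^ m := by positivity
  have hL : v i * k ≤ util v m i (s * (k + 1)) (s * l) ∧
      util v m i (s * (k + 1)) (s * l) ≤ v i * (k + 1) := by
    match l with
    | 0 =>
      have c : InCell k 0 (s * (k + 1)) 0 :=
        ⟨by positivity, le_rfl, Or.inr (by simp; positivity), Or.inl rfl⟩
      have r0 : Rich v m 0 := hrx.mono (by positivity)
      simp only [CharP.cast_eq_zero, mul_zero]
      exact ⟨H.cell_ge hrx r0 (by omega) c, by linarith [H.cell_le (i := i) hrx r0 (by omega) c]⟩
    | l + 1 =>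
      have hb : ((k : ℝ) + 1) * (s * (l + 1 : ℕ)) = (l + 1) * (s * (k + 1)) := by push_cast; ring
      have h1 := H.boundary_ge (i := i) hrx ry (by omega) (by positivity) hb
      have h2 := H.boundary_le (i := i) hrx ry (by omega) (by positivity) hb
      exact ⟨by linarith, h2⟩
  have hW : (k : ℝ) = 0 ∧ util v m i (s * k) (s * (l + 1)) = 0 ∨
      v i * (k - 1) + v i / 2 ^ m ≤ util v m i (s * k) (s * (l + 1)) ∧
        util v m i (s * k) (s * (l + 1)) ≤ v i * k := by
    match k with
    | 0 =>
      have c : InCell 0 l 0 (s * (l + 1)) :=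
        ⟨le_rfl, by positivity, Or.inl rfl, Or.inr (by simp; positivity)⟩
      have r0 : Rich v m 0 := hrx.mono (by positivity)
      simp only [CharP.cast_eq_zero, mul_zero]
      rw [H.cell r0 hry (by omega) c, remaining_zero]
      simp
    | k + 1 =>
      have hb : ((k : ℝ) + 1) * (s * (l + 1)) = (l + 1) * (s * (k + 1 : ℕ)) := by push_cast; ring
      have h1 := H.boundary_ge (i := i) rx hry (by omega) (by positivity) hb
      have h2 := H.boundary_le (i := i) rx hry (by omega) (by positivity) hb
      push_cast at h1 h2 ⊢
      exact Or.inr ⟨by linarith, h2⟩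
  obtain ⟨hL1, hL2⟩ := hL
  rw [hpow]
  rcases hW with ⟨h0, h1⟩ | ⟨h1, h2⟩
  · have h2 : v i * k = 0 := by rw [h0, mul_zero]
    rw [h1]
    exact ⟨by linarith, by linarith⟩
  · exact ⟨by linarith, by linarith⟩

theorem UtilSpec.succ (H : UtilSpec v m) : UtilSpec v (m + 1) := by
  have bd : ∀ {i k l x y}, Rich v (m + 1) x → Rich v (m + 1) y → k + 1 + l = m + 1 → 0 < x →
      ((k : ℝ) + 1) * y = (l + 1) * x → v i * k + v i / 2 ^ (m + 1) ≤ util v (m + 1) i x y ∧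
      util v (m + 1) i x y ≤ v i * (k + 1) := by
    intro i k l x y hrx hry hm hx hb
    have hy : 0 < y := pos_of_mul_pos_right (hb ▸ (by positivity)) (by positivity : (0 : ℝ) ≤ k + 1)
    have rx := hrx.of_succ hx.le
    have ry := hry.of_succ hy.le
    have e1 : x = x / (k + 1) * (k + 1) := by field_simp
    have e2 : y = x / (k + 1) * (l + 1) := by field_simp; linarith
    have hs0 : 0 < x / (k + 1) := by positivity
    set s := x / (k + 1)
    rw [e1] at rx ⊢
    rw [e2] at ry ⊢
    exact H.boundary_succ (by omega) hs0 rx ry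
  refine ⟨?_, fun h1 h2 h3 h4 h5 => (bd h1 h2 h3 h4 h5).1, fun h1 h2 h3 h4 h5 => (bd h1 h2 h3 h4 h5).2⟩
  intro i k l x y hrx hry hm hc
  have rx := hrx.of_succ hc.left_nonneg
  have ry := hry.of_succ hc.right_nonneg
  obtain ⟨hw, hl⟩ := H.winKeeps (i := i) hm hc rx ry
  apply util_succ_eq
  · intro hle
    obtain ⟨k', rfl, hp, hX, h1, h2⟩ := hw hle
    have h0 := crit_nonneg (v := v) (m := m) (i := opp i) (x := y) (y := x)
    rw [max_eq_left (by linarith), H.cell (rx.mono (by linarith)) ry (by omega) hX, h1]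
    push_cast
    ring
  · intro hle
    have h0 := crit_nonneg (v := v) (m := m) (i := i) (x := x) (y := y)
    unfold WinKeeps at hl
    rw [opp_opp] at hl
    obtain ⟨l', rfl, hp, hX, h1, h2⟩ := hl hle
    rw [max_eq_left (by linarith), H.cell rx (ry.mono (by linarith)) (by omega) hX.symm, h2]

theorem utilSpec (v : Agent → ℝ) (m : ℕ) : UtilSpec v m := by
  induction m with
  | zero => exact utilSpec_zero v
  | succ m ih => exact ih.succ

end Outcome

/-! ### Realizations -/

theorem sum_agents (K : Agent → ℕ) (i : Agent) : K 0 + K 1 = K i + K (opp i) := by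
  fin_cases i
  · rfl
  · exact add_comm _ _

theorem itemsWon_cons_self (w : Agent) (p : ℝ) (h : List (Agent × ℝ)) :
    itemsWon ((w, p) :: h) w = itemsWon h w + 1 := by
  simp [itemsWon]

theorem itemsWon_cons_opp (w : Agent) (p : ℝ) (h : List (Agent × ℝ)) :
    itemsWon ((w, p) :: h) (opp w) = itemsWon h (opp w) := by
  simp [itemsWon, (opp_ne w).symm]

section Bids

variable {v : Agent → ℝ} {m : ℕ} {b : Agent → ℝ} {i : Agent} {p : ℝ}

theorem canonBid_eq (v : Agent → ℝ) (m : ℕ) (b : Agent → ℝ) (i : Agent) :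
    canonBid v m b i = ⟨min (crit v m i (b i) (b (opp i))) (crit v m (opp i) (b (opp i)) (b i)),
      decide (crit v m (opp i) (b (opp i)) (b i) < crit v m i (b i) (b (opp i)))⟩ := by
  rw [← canonBid_pair, pair_eta]

theorem canonBid_tie (h1 : crit v m i (b i) (b (opp i)) = p)
    (h2 : crit v m (opp i) (b (opp i)) (b i) = p) : canonBid v m b i = ⟨p, false⟩ := by
  rw [canonBid_eq, h1, h2]; simp

theorem canonBid_lower (h1 : crit v m i (b i) (b (opp i)) = p)
    (h2 : p < crit v m (opp i) (b (opp i)) (b i)) : canonBid v m b i = ⟨p, false⟩ := by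
  rw [canonBid_eq, h1]; simp [h2.le]

theorem canonBid_higher (h1 : crit v m i (b i) (b (opp i)) = p)
    (h2 : p < crit v m (opp i) (b (opp i)) (b i)) : canonBid v m b (opp i) = ⟨p, true⟩ := by
  rw [canonBid_eq, opp_opp, h1]; simp [h2.le, h2]

/-- Who may win the first item, and what she pays. -/
theorem winner_spec (h : ¬ (canonBid v m b (opp i)).Beats (canonBid v m b i)) :
    crit v m (opp i) (b (opp i)) (b i) ≤ crit v m i (b i) (b (opp i)) ∧
    (canonBid v m b i).amount = crit v m (opp i) (b (opp i)) (b i) := by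
  have h1 := h
  rw [← pair_eta i b, not_beats_iff] at h1
  exact ⟨h1, by rw [canonBid_eq, min_eq_right h1]⟩

theorem pay_self (b : Agent → ℝ) (i : Agent) {p : ℝ} (hp : p ≤ b i) : pay b i p i = b i - p := by
  simp [pay, hp]

theorem pay_opp (b : Agent → ℝ) (i : Agent) (p : ℝ) : pay b i p (opp i) = b (opp i) := by
  simp [pay, opp_ne]

theorem pay_le (hp : 0 ≤ p) (hb : 0 ≤ b i) (j : Agent) : pay b i p j ≤ b j := by
  rcases eq_or_eq_opp i j with rfl | rfl
  · simp [pay, hp, hb]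
  · rw [pay_opp]

end Bids

/-- A property of the number of items left and of the budgets that every round preserves holds
throughout. -/
theorem Reach.invariant {v : Agent → ℝ} {Inv : ℕ → (Agent → ℝ) → Prop}
    (step : ∀ n b w, Inv (n + 1) b → ¬ (canonBid v n b (opp w)).Beats (canonBid v n b w) →
      Inv n (pay b w (canonBid v n b w).amount))
    {n m : ℕ} {b c : Agent → ℝ} {h : List (Agent × ℝ)} (hr : Reach v n b h m c) (h0 : Inv n b) :
    Inv m c := by
  induction hr with
  | refl => exact h0
  | round hwin _ ih => exact ih (step _ _ _ h0 hwin)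

/-- The same for a property of the numbers of items that the agents have yet to win. -/
theorem Reach.invariant_counts {v : Agent → ℝ} {Inv : (Agent → ℕ) → (Agent → ℝ) → Prop}
    (step : ∀ n K b w, K 0 + K 1 = n + 1 → Inv K b →
      ¬ (canonBid v n b (opp w)).Beats (canonBid v n b w) →
      ∃ K', Inv K' (pay b w (canonBid v n b w).amount) ∧ K' w + 1 = K w ∧
        K' (opp w) = K (opp w))
    {n m : ℕ} {b c : Agent → ℝ} {h : List (Agent × ℝ)} (hr : Reach v n b h m c)
    {K : Agent → ℕ} (hK : K 0 + K 1 = n) (h0 : Inv K b) :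
    ∃ K', Inv K' c ∧ K' 0 + K' 1 = m ∧ ∀ j, K' j + itemsWon h j = K j := by
  induction hr generalizing K with
  | refl => exact ⟨K, h0, hK, fun j => rfl⟩
  | @round n b w h m c hwin _ ih =>
    obtain ⟨K', h1, h2, h3⟩ := step _ K _ w hK h0 hwin
    rw [sum_agents K w] at hK
    obtain ⟨K'', g1, g2, g3⟩ := ih (K := K') (by rw [sum_agents K' w]; omega) h1
    refine ⟨K'', g1, g2, fun j => ?_⟩
    rcases eq_or_eq_opp w j with rfl | rfl
    · rw [itemsWon_cons_self]
      have := g3 j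
      omega
    · rw [itemsWon_cons_opp, g3, h3]

/-- In a cell, ties do not matter. -/
theorem tiesIrrelevant_of_inCell {v : Agent → ℝ} {K : Agent → ℕ} {b : Agent → ℝ} {i : Agent}
    (hr : ∀ j, Rich v (K 0 + K 1) (b j))
    (h : InCell (K i) (K (opp i)) (b i) (b (opp i))) : TiesIrrelevant v K b := by
  have both : ∀ j, InCell (K j) (K (opp j)) (b j) (b (opp j)) := by
    intro j
    rcases eq_or_eq_opp i j with rfl | rfl
    · exact h
    · rw [opp_opp]; exact h.symm
  intro g c hg j
  -- Invariant: the budgets stay in the cell of the items still to be won, and the predicted final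
  -- budgets do not change. With no items left the prediction is the budget itself.
  obtain ⟨K', ⟨-, h2, h3⟩, hsum, hcount⟩ := hg.invariant_counts
    (Inv := fun K' c => (∀ j, Rich v (K' 0 + K' 1) (c j)) ∧
      (∀ j, InCell (K' j) (K' (opp j)) (c j) (c (opp j))) ∧
      ∀ j, remaining (K' j) (K' (opp j)) (c j) (c (opp j)) =
        remaining (K j) (K (opp j)) (b j) (b (opp j))) (by
    rintro n K' c w hn ⟨g1, g2, g3⟩ hwin
    obtain ⟨hle, hamt⟩ := winner_spec hwin
    have hn' := sum_agents K' w
    rw [hn] at g1 hn'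
    have r1 := (g1 w).of_succ (g2 w).left_nonneg
    have r2 := (g1 (opp w)).of_succ (g2 w).right_nonneg
    obtain ⟨k', hk, hpx, hc, e1, e2⟩ := ((utilSpec v n).winKeeps hn'.symm (g2 w) r1 r2).1 hle
    have hp0 := crit_nonneg (v := v) (m := n) (i := opp w) (x := c (opp w)) (y := c w)
    rw [hamt]
    set p := crit v n (opp w) (c (opp w)) (c w)
    refine ⟨pair w k' (K' (opp w)), ⟨?_, ?_, ?_⟩, by rw [pair_self, hk], pair_of_opp _ _ _⟩
    · intro j
      have : pair w k' (K' (opp w)) 0 + pair w k' (K' (opp w)) 1 = n := by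
        rw [sum_agents _ w, pair_self, pair_of_opp]; omega
      rw [this]
      exact ((g1 j).of_succ (g2 j).left_nonneg).mono (pay_le hp0 (g2 w).left_nonneg j)
    · intro j
      rcases eq_or_eq_opp w j with rfl | rfl
      · rw [pair_self, pair_of_opp, pay_self _ _ hpx, pay_opp]; exact hc
      · rw [opp_opp, pair_self, pair_of_opp, pay_self _ _ hpx, pay_opp]; exact hc.symm
    · intro j
      rw [← g3 j]
      rcases eq_or_eq_opp w j with rfl | rfl
      · rw [pair_self, pair_of_opp, pay_self _ _ hpx, pay_opp]; exact e1
      · rw [opp_opp, pair_self, pair_of_opp, pay_self _ _ hpx, pay_opp]; exact e2)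
    rfl ⟨hr, both, fun j => rfl⟩
  have hz : ∀ j, K' j = 0 := by
    intro j
    have := sum_agents K' j
    omega
  have h4 := hcount j
  rw [hz j, zero_add] at h4
  refine ⟨h4, ?_⟩
  have h5 := h3 j
  rw [hz, remaining_zero] at h5
  rw [h5, ← (utilSpec v (K 0 + K 1)).cell (hr j) (hr (opp j)) (sum_agents K j).symm (both j),
    util, pair_eta]

/-! ### Ties on the boundary and on the middle line. -/

/-- Type I ties. -/
theorem typeITie_of_boundary {v : Agent → ℝ} {n : ℕ} {K : Agent → ℕ} {b : Agent → ℝ} {p : ℝ}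
    (hp : 0 < p) (hr : ∀ j, Rich v n (b j)) (hK : K 0 + K 1 = n + 1) (hpos : ∀ j, 0 < K j)
    (hb : ∀ j, b j = p * K j) : TypeITie v n b p := by
  have hcrit : ∀ {n : ℕ} {K : Agent → ℕ} {c : Agent → ℝ}, (∀ j, Rich v (n + 1) (c j)) →
      K 0 + K 1 = n + 1 + 1 → (∀ j, 0 < K j) → (∀ j, c j = p * K j) →
      ∀ j, crit v n j (c j) (c (opp j)) = p := by
    intro n K c hr hK hpos hc j
    have hK' := sum_agents K j
    have h1 := (hr j).of_succ (by rw [hc]; positivity)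
    have h2 := (hr (opp j)).of_succ (by rw [hc]; positivity)
    obtain ⟨k, hk⟩ := Nat.exists_eq_add_of_lt (hpos j)
    obtain ⟨l, hl⟩ := Nat.exists_eq_add_of_lt (hpos (opp j))
    rw [zero_add] at hk hl
    rw [hc, hk] at h1 ⊢
    rw [hc, hl] at h2 ⊢
    push_cast at h1 h2 ⊢
    exact (utilSpec v n).crit_boundary (by omega) hp h1 h2
  have hzero : ∀ {n : ℕ} {c : Agent → ℝ} {j : Agent}, (∀ j, Rich v (n + 1) (c j)) → c j = 0 →
      0 < c (opp j) → crit v n j (c j) (c (opp j)) = 0 ∧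
        0 < crit v n (opp j) (c (opp j)) (c j) := by
    intro n c j hr h0 hpos
    have := (utilSpec v n).crit_poor (i := j) h0.ge (by rw [h0]; simpa using hpos)
      ((hr j).of_succ h0.ge) ((hr (opp j)).of_succ hpos.le)
    rw [h0] at this ⊢
    exact this
  intro g m c hg
  -- The budgets are positive multiples of `p` whose multiplicities add up to one more than the
  -- number of items left, until one agent is at zero; from then on the other wins for free and no
  -- budget changes.
  have hinv := hg.invariant (Inv := fun n c => (∀ j, Rich v n (c j)) ∧
    ((∃ K : Agent → ℕ, K 0 + K 1 = n + 1 ∧ (∀ j, 0 < K j) ∧ ∀ j, c j = p * K j) ∨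
      ∃ j, c j = 0 ∧ 0 < c (opp j))) (by
    rintro n c w ⟨h1, h2⟩ hwin
    obtain ⟨hle, hamt⟩ := winner_spec hwin
    rcases h2 with ⟨K, hK, hpos, hc⟩ | ⟨j, h0, hpos⟩
    · have hcw := hcrit h1 hK hpos hc (opp w)
      rw [opp_opp] at hcw
      rw [hamt, hcw]
      have hcn : ∀ j, 0 ≤ c j := fun j => by rw [hc]; positivity
      refine ⟨fun j => ((h1 j).of_succ (hcn j)).mono (pay_le hp.le (hcn w) j), ?_⟩
      obtain ⟨k, hk⟩ := Nat.exists_eq_add_of_lt (hpos w)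
      have hpw : p ≤ c w := by
        rw [hc, hk]; push_cast; nlinarith [mul_nonneg hp.le (Nat.cast_nonneg (α := ℝ) k)]
      have hcw' : pay c w p w = p * k := by
        rw [pay_self _ _ hpw, hc, hk]; push_cast; ring
      rw [sum_agents K w] at hK
      rcases Nat.eq_zero_or_pos k with h0 | h0
      · refine Or.inr ⟨w, by rw [hcw', h0]; simp, ?_⟩
        rw [pay_opp, hc]
        have := hpos (opp w)
        positivity
      · refine Or.inl ⟨pair w k (K (opp w)), ?_, fun j => ?_, fun j => ?_⟩
        · rw [sum_agents _ w, pair_self, pair_of_opp]; omega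
        · rcases eq_or_eq_opp w j with rfl | rfl
          · rwa [pair_self]
          · rw [pair_of_opp]; exact hpos _
        · rcases eq_or_eq_opp w j with rfl | rfl
          · rw [pair_self, hcw']
          · rw [pair_of_opp, pay_opp, hc]
    · obtain ⟨e1, e2⟩ := hzero h1 h0 hpos
      have hw : w = opp j := by
        rcases eq_or_eq_opp j w with rfl | rfl
        · exact absurd hle (not_le.mpr (by rw [e1]; exact e2))
        · rfl
      subst hw
      rw [opp_opp] at hamt
      rw [hamt, e1]
      have hpay : pay c (opp j) 0 = c := by
        funext t
        simp only [pay, sub_zero, max_eq_left hpos.le, Function.update_eq_self]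
      rw [hpay]
      have hcn : ∀ t, 0 ≤ c t := fun t => by
        rcases eq_or_eq_opp j t with rfl | rfl
        · exact h0.ge
        · exact hpos.le
      exact ⟨fun t => (h1 t).of_succ (hcn t), Or.inr ⟨j, h0, hpos⟩⟩)
    ⟨hr, Or.inl ⟨K, hK, hpos, hb⟩⟩
  obtain ⟨h1, ⟨K', hK', hpos', hc⟩ | ⟨j, h0, hpos'⟩⟩ := hinv
  · refine Or.inl fun j => ⟨?_, ?_⟩
    · rw [hc]
      have := hpos' j
      positivity
    · have h2 := hcrit h1 hK' hpos' hc (opp j)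
      rw [opp_opp] at h2
      exact canonBid_tie (hcrit h1 hK' hpos' hc j) h2
  · obtain ⟨e1, e2⟩ := hzero h1 h0 hpos'
    exact Or.inr ⟨j, h0, canonBid_lower e1 e2, canonBid_higher e1 e2⟩

/-- Type II-A ties. -/
theorem typeIIATie_of_mid {v : Agent → ℝ} {n : ℕ} {K : Agent → ℕ} {b : Agent → ℝ} {p : ℝ}
    (hp : 0 < p) (hr : ∀ j, Rich v n (b j)) (hK : K 0 + K 1 = n)
    (hb : ∀ j, b j = p * (K j + 1)) : TypeIIATie v n b p := by
  have hcrit : ∀ {n : ℕ} {K : Agent → ℕ} {c : Agent → ℝ}, (∀ j, Rich v (n + 1) (c j)) →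
      K 0 + K 1 = n + 1 → (∀ j, 0 < K j) → (∀ j, c j = p * (K j + 1)) →
      ∀ j, crit v n j (c j) (c (opp j)) = p := by
    intro n K c hr hK hpos hc j
    have hK' := sum_agents K j
    have h1 := (hr j).of_succ (by rw [hc]; positivity)
    have h2 := (hr (opp j)).of_succ (by rw [hc]; positivity)
    obtain ⟨k, hk⟩ := Nat.exists_eq_add_of_lt (hpos j)
    obtain ⟨l, hl⟩ := Nat.exists_eq_add_of_lt (hpos (opp j))
    rw [zero_add] at hk hl
    have e1 : c j = p * (k + 2) := by rw [hc, hk]; push_cast; ring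
    have e2 : c (opp j) = p * (l + 2) := by rw [hc, hl]; push_cast; ring
    rw [e1] at h1 ⊢
    rw [e2] at h2 ⊢
    exact (utilSpec v n).crit_mid (by omega) hp h1 h2
  have hzero : ∀ {n : ℕ} {K : Agent → ℕ} {c : Agent → ℝ} {j : Agent},
      (∀ j, Rich v (n + 1) (c j)) → K 0 + K 1 = n + 1 → K j = 0 → (∀ j, c j = p * (K j + 1)) →
      crit v n j (c j) (c (opp j)) = p ∧ p < crit v n (opp j) (c (opp j)) (c j) := by
    intro n K c j hr hK h0 hc
    have hK' := sum_agents K j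
    have e1 : c j = p := by rw [hc, h0]; simp
    have e2 : c (opp j) = p * (n + 2) := by
      rw [hc, show K (opp j) = n + 1 by omega]; push_cast; ring
    have := (utilSpec v n).crit_poor (i := j) (x := c j) (y := c (opp j)) (by rw [e1]; exact hp.le)
      (by rw [e1, e2]; nlinarith)
      ((hr j).of_succ (by rw [e1]; exact hp.le)) ((hr (opp j)).of_succ (by rw [e2]; positivity))
    rw [e1] at this ⊢
    exact this
  have hother : ∀ {n : ℕ} {K : Agent → ℕ} {w : Agent}, K 0 + K 1 = n + 1 → ¬ (∀ j, 0 < K j) →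
      K w ≠ 0 → K (opp w) = 0 := by
    intro n K w hK hn hw
    by_contra hc
    refine hn fun j => ?_
    rcases eq_or_eq_opp w j with rfl | rfl <;> omega
  intro g m c hg
  -- Each budget is `p` times one more than the number of items that the agent has yet to win, and
  -- each win lowers both by one unit. An agent with nothing more to win holds exactly `p`.
  have hinv := hg.invariant (Inv := fun n c => (∀ j, Rich v n (c j)) ∧
    ∃ K : Agent → ℕ, K 0 + K 1 = n ∧ ∀ j, c j = p * (K j + 1)) (by
    rintro n c w ⟨h1, K, hK, hc⟩ hwin
    obtain ⟨hle, hamt⟩ := winner_spec hwin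
    have hcn : ∀ j, 0 ≤ c j := fun j => by rw [hc]; positivity
    have key : crit v n (opp w) (c (opp w)) (c w) = p ∧ 0 < K w := by
      by_cases hpos : ∀ j, 0 < K j
      · have hcw := hcrit h1 hK hpos hc (opp w)
        rw [opp_opp] at hcw
        exact ⟨hcw, hpos w⟩
      · by_cases h0 : K w = 0
        · obtain ⟨e1, e2⟩ := hzero h1 hK h0 hc
          exact absurd hle (not_le.mpr (by rw [e1]; exact e2))
        · have := (hzero h1 hK (hother hK hpos h0) hc).1
          rw [opp_opp] at this
          exact ⟨this, Nat.pos_of_ne_zero h0⟩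
    rw [hamt, key.1]
    refine ⟨fun j => ((h1 j).of_succ (hcn j)).mono (pay_le hp.le (hcn w) j), ?_⟩
    obtain ⟨k, hk⟩ := Nat.exists_eq_add_of_lt key.2
    have hpw : p ≤ c w := by
      rw [hc]; nlinarith [mul_nonneg hp.le (Nat.cast_nonneg (α := ℝ) (K w))]
    rw [sum_agents K w] at hK
    refine ⟨pair w k (K (opp w)), ?_, fun j => ?_⟩
    · rw [sum_agents _ w, pair_self, pair_of_opp]; omega
    · rcases eq_or_eq_opp w j with rfl | rfl
      · rw [pair_self, pay_self _ _ hpw, hc, hk]; push_cast; ring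
      · rw [pair_of_opp, pay_opp, hc])
    ⟨hr, K, hK, hb⟩
  obtain ⟨h1, K', hK', hc⟩ := hinv
  by_cases hpos : ∀ j, 0 < K' j
  · refine Or.inl fun j => ⟨?_, ?_⟩
    · rw [hc]
      have : (0 : ℝ) < K' j := by exact_mod_cast hpos j
      nlinarith
    · have h2 := hcrit h1 hK' hpos hc (opp j)
      rw [opp_opp] at h2
      exact canonBid_tie (hcrit h1 hK' hpos hc j) h2
  · obtain ⟨j, hj⟩ := not_forall.mp hpos
    have hj0 : K' j = 0 := by omega
    obtain ⟨e1, e2⟩ := hzero h1 hK' hj0 hc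
    exact Or.inr ⟨j, by rw [hc, hj0]; simp, canonBid_lower e1 e2, canonBid_higher e1 e2⟩

/-! ### Two-phase realizations and Type II-B ties in the lower half. -/

section LowerHalf

variable {v : Agent → ℝ} {i : Agent} {k l : ℕ} {x y : ℝ}

theorem Reach.cons {m n : ℕ} {p : ℝ} {h : List (Agent × ℝ)} {c : Agent → ℝ}
    (hp : crit v n (opp i) y x = p) (hle : p ≤ crit v n i x y) (hpx : p ≤ x)
    (hr : Reach v n (pair i (x - p) y) h m c) :
    Reach v (n + 1) (pair i x y) ((i, p) :: h) m c := by
  have hwin : ¬ (canonBid v n (pair i x y) (opp i)).Beats (canonBid v n (pair i x y) i) := by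
    rw [not_beats_iff, hp]; exact hle
  have hamt : (canonBid v n (pair i x y) i).amount = p := by
    rw [canonBid_pair, hp, min_eq_right hle]
  have := Reach.round (h := h) (m := m) (c := c) hwin (by
    rwa [hamt, pay_pair, max_eq_left (by linarith)])
  rwa [hamt] at this

/-- If agent `i` certainly wins the first item at price `p`, then every realization starts like
that. -/
theorem Reach.uncons {n : ℕ} {p : ℝ} {h : List (Agent × ℝ)} {c : Agent → ℝ}
    (hp : crit v n (opp i) y x = p) (hlt : p < crit v n i x y) (hpx : p ≤ x)
    (hr : Reach v (n + 1) (pair i x y) h 0 c) :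
    ∃ h', h = (i, p) :: h' ∧ Reach v n (pair i (x - p) y) h' 0 c := by
  cases hr with
  | @round _ _ w h' _ _ hwin hrest =>
    rcases eq_or_eq_opp i w with rfl | rfl
    · have hamt : (canonBid v n (pair w x y) w).amount = p := by
        rw [canonBid_pair, hp, min_eq_right hlt.le]
      rw [hamt, pay_pair, max_eq_left (by linarith)] at hrest
      exact ⟨h', by rw [hamt], hrest⟩
    · exact absurd ((beats_iff' v n i x y).mpr (by rw [hp]; exact hlt)) (by rwa [opp_opp] at hwin)

theorem LowerHalf.le_left (h : LowerHalf (k + 1) 0 x y) : y < x := by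
  have h1 := h.cell
  push_cast at h1
  nlinarith [mul_nonneg (Nat.cast_nonneg (α := ℝ) k) h.pos.le]

/-- In the lower half of a cell, the first agent possibly wins the first item. -/
theorem lowerHalf_step {n : ℕ} (hn : k + l = n) (h : LowerHalf (k + 1) l x y)
    (hrx : Rich v n x) (hry : Rich v n y) :
    ∃ p, 0 ≤ p ∧ p ≤ x ∧ crit v n (opp i) y x = p ∧ p ≤ crit v n i x y ∧
      LowerHalf k l (x - p) y := by
  match l with
  | 0 =>
    obtain rfl : k = n := by omega
    have hc := h.cell
    have hh := h.half
    push_cast at hc hh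
    obtain ⟨h1, h2⟩ := (utilSpec v k).crit_poor (i := opp i) h.pos.le (by linarith) hry hrx
    rw [opp_opp] at h2
    exact ⟨y, h.pos.le, h.le_left.le, h1, h2.le,
      h.pos, by push_cast; linarith, by push_cast; linarith⟩
  | l + 1 =>
    have hX := h.lose
    have hp := h.leftover_pos.trans_le (leftover_le_price h)
    have hh := h.half
    push_cast at hh
    rcases lt_or_eq_of_le (show ((l : ℝ) + 2) * x ≤ (k + 2) * y by linarith) with hs | hs
    · obtain ⟨h1, h2, h3⟩ := (utilSpec v n).crit_lower (i := i) hn h hs hrx hry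
      refine ⟨_, hp.le, by linarith [hX.pos_left], h1, ?_, hX⟩
      rcases lt_trichotomy (leftover (k + 1) l x (y - price k l x y))
        (leftover (k + 1) (l + 1) x y) with hY | hY | hY
      · exact (h2 hY).le
      · exact (h3 hY).ge
      · match l with
        | 0 => exact absurd (won_lt_lost h (by push_cast at hs; linarith)) (not_lt.mpr hY.le)
        | l + 1 => exact absurd (won_le_lost h) (not_le.mpr hY)
    · have hx := h.pos_left
      have e1 : x = x / (k + 2) * (k + 2) := by field_simp
      have e2 : y = x / (k + 2) * (l + 2) := by field_simp; linarith
      have hs0 : 0 < x / (k + 2) := by positivity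
      have hpx : x / (k + 2) ≤ x :=
        div_le_self hx.le (by linarith [Nat.cast_nonneg (α := ℝ) k])
      have h3 : LowerHalf k (l + 1) (x - x / (k + 2)) y := by
        have hc := InCell.mid k (l + 1) hs0
        have e3 : x - x / (k + 2) = x / (k + 2) * (k + 1) := by field_simp; ring
        rw [e3]
        refine ⟨h.pos, ?_, ?_⟩ <;> rw [e2] <;> push_cast
        · nlinarith [mul_pos hs0 (show (0 : ℝ) < l + 2 by positivity)]
        · exact le_of_eq (by ring)
      have g1 := (utilSpec v n).crit_mid (i := opp i) (k := l) (l := k) (by omega) hs0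
        (by rwa [← e2]) (by rwa [← e1])
      have g2 := (utilSpec v n).crit_mid (i := i) (k := k) (l := l) (by omega) hs0
        (by rwa [← e1]) (by rwa [← e2])
      rw [← e1, ← e2] at g1 g2
      exact ⟨_, hs0.le, hpx, g1, g2.ge, h3⟩

theorem crit_of_lowerHalf_zero {n : ℕ} (h : LowerHalf 0 (n + 1) x y) (hrx : Rich v n x)
    (hry : Rich v n y) : crit v n i x y = x ∧ x < crit v n (opp i) y x := by
  have hh := h.half
  have hx := h.pos_left
  push_cast at hh
  exact (utilSpec v n).crit_poor hx.le (by linarith) hrx hry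

theorem LowerHalf.second_phase (h : LowerHalf 0 (l + 1) x y) :
    x < y ∧ LowerHalf 0 l x (y - x) := by
  have hh := h.half
  have hx := h.pos_left
  have hlx : 0 ≤ l * x := by positivity
  push_cast at hh
  exact ⟨by linarith, by linarith, by push_cast; simp; positivity, by push_cast; linarith⟩

/-- In the second phase, the second agent certainly wins everything at the same price. -/
theorem reach_second_phase (h : LowerHalf 0 l x y) (hrx : Rich v l x) (hry : Rich v l y) :
    (∃ c, Reach v l (pair i x y) (List.replicate l (opp i, x)) 0 c) ∧
      ∀ g c, Reach v l (pair i x y) g 0 c → g = List.replicate l (opp i, x) := by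
  induction l generalizing y with
  | zero => exact ⟨⟨_, Reach.refl _ _⟩, fun g c hg => by cases hg; rfl⟩
  | succ l ih =>
    have rx := hrx.of_succ h.pos_left.le
    have ry := hry.of_succ h.pos.le
    obtain ⟨h1, h2⟩ := crit_of_lowerHalf_zero (i := i) h rx ry
    obtain ⟨h3, h4⟩ := h.second_phase
    obtain ⟨⟨c, hc⟩, hu⟩ := ih h4 rx (ry.mono (by linarith [h.pos_left]))
    rw [List.replicate_succ, ← pair_opp]
    rw [← pair_opp] at hc
    refine ⟨⟨c, Reach.cons (by rw [opp_opp]; exact h1) h2.le h3.le hc⟩, fun g c' hg => ?_⟩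
    obtain ⟨g', rfl, hg'⟩ := hg.uncons (by rw [opp_opp]; exact h1) h2 h3.le
    rw [pair_opp] at hg'
    rw [hu g' c' hg']

theorem isTwoPhase_second (i : Agent) (l : ℕ) (x y : ℝ) :
    IsTwoPhase (pair i 0 l) i (pair i x y) (List.replicate l (opp i, x)) := by
  refine ⟨by simp [pair_self, pair_of_opp], ?_⟩
  rw [pair_self]
  intro z hz
  rw [List.drop_zero] at hz
  rw [List.eq_of_mem_replicate hz]
  simp [pair_self]

theorem IsTwoPhase.cons {h : List (Agent × ℝ)} {p : ℝ}
    (hh : IsTwoPhase (pair i k l) i (pair i (x - p) y) h) :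
    IsTwoPhase (pair i (k + 1) l) i (pair i x y) ((i, p) :: h) := by
  obtain ⟨h1, h2⟩ := hh
  rw [pair_self, pair_of_opp] at h1
  rw [pair_self, pair_self] at h2
  refine ⟨?_, ?_⟩
  · rw [pair_self, pair_of_opp, List.map_cons, h1, List.replicate_succ, List.cons_append]
  · rw [pair_self, pair_self]
    intro z hz
    rw [List.drop_succ_cons] at hz
    rw [h2 z hz, List.take_succ_cons, List.map_cons, List.sum_cons]
    ring

theorem exists_twoPhase {n : ℕ} (hn : k + l = n) (h : LowerHalf k l x y) (hrx : Rich v n x)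
    (hry : Rich v n y) : ∃ g c, Reach v n (pair i x y) g 0 c ∧
      IsTwoPhase (pair i k l) i (pair i x y) g := by
  induction k generalizing n x with
  | zero =>
    obtain rfl : l = n := by omega
    obtain ⟨⟨c, hc⟩, -⟩ := reach_second_phase (i := i) h hrx hry
    exact ⟨_, c, hc, isTwoPhase_second i l x y⟩
  | succ k ih =>
    obtain ⟨n, rfl⟩ : ∃ n', n = n' + 1 := ⟨k + l, by omega⟩
    have rx := hrx.of_succ h.pos_left.le
    have ry := hry.of_succ h.pos.le
    obtain ⟨p, hp0, hpx, h1, h2, h3⟩ := lowerHalf_step (i := i) (by omega) h rx ry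
    obtain ⟨g, c, hg, ht⟩ := ih (by omega) h3 (rx.mono (by linarith)) ry
    exact ⟨_, c, hg.cons h1 h2 hpx, ht.cons⟩

/-- With equal shares both agents are indifferent at T as long as the opponent has at least two
items to win. With only one the first agent is strictly more eager, which is why the tie stops at
k(-i) - 1 wins of the opponent. -/
theorem crit_equal_share {n : ℕ} (hn : k + l + 1 = n) (h : LowerHalf (k + 1) (l + 1) x y)
    (hs : (l + 2) * x < (k + 2) * y) (he : (k + 2) * leftover (k + 1) (l + 1) x y = x)
    (hrx : Rich v n x) (hry : Rich v n y) :
    crit v n (opp i) y x = leftover (k + 1) (l + 1) x y ∧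
    (l = 0 → leftover (k + 1) (l + 1) x y < crit v n i x y) ∧
    (0 < l → crit v n i x y = leftover (k + 1) (l + 1) x y ∧
      leftover (k + 1) l x (y - leftover (k + 1) (l + 1) x y) =
        leftover (k + 1) (l + 1) x y) := by
  obtain ⟨h1, h2, h3⟩ := (utilSpec v n).crit_lower (i := i) hn h hs hrx hry
  have hp := price_of_equal_share h he
  rw [hp] at h1 h2 h3
  refine ⟨h1, fun hl => h2 ?_, fun hl => ?_⟩
  · subst hl
    have := won_lt_lost h (by push_cast at hs; linarith)
    rwa [hp] at this
  · obtain ⟨l, rfl⟩ : ∃ l', l = l' + 1 := ⟨l - 1, by omega⟩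
    have := won_of_equal_share h he
    rw [hp] at this
    exact ⟨h3 this, this⟩

/-- The situations in a Type II-B tie with price `p`. -/
structure EqualShare (i : Agent) (p : ℝ) (K : Agent → ℕ) (b : Agent → ℝ) : Prop where
  lower : LowerHalf (K i) (K (opp i)) (b i) (b (opp i))
  strict : (K (opp i) + 1) * b i < (K i + 1) * b (opp i)
  leftover_eq : leftover (K i) (K (opp i)) (b i) (b (opp i)) = p
  budget : (K i + 1) * p = b i
  right_pos : K i = 0 ∨ 0 < K (opp i)

theorem EqualShare.budget_nonneg {p : ℝ} {K : Agent → ℕ} {b : Agent → ℝ}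
    (h : EqualShare i p K b) (j : Agent) : 0 ≤ b j := by
  rcases eq_or_eq_opp i j with rfl | rfl
  · exact h.lower.pos_left.le
  · exact h.lower.pos.le

/-- The critical prices during a Type II-B tie. -/
theorem EqualShare.crit_cases {n : ℕ} {p : ℝ} {K : Agent → ℕ} {b : Agent → ℝ}
    (h : EqualShare i p K b) (hK : K 0 + K 1 = n + 1) (hr : ∀ j, Rich v (n + 1) (b j)) :
    (K i = 0 ∧ crit v n i (b i) (b (opp i)) = p ∧ p < crit v n (opp i) (b (opp i)) (b i)) ∨
    (0 < K i ∧ K (opp i) = 1 ∧ crit v n (opp i) (b (opp i)) (b i) = p ∧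
      p < crit v n i (b i) (b (opp i))) ∨
    (0 < K i ∧ 1 < K (opp i) ∧ crit v n (opp i) (b (opp i)) (b i) = p ∧
      crit v n i (b i) (b (opp i)) = p ∧
      leftover (K i) (K (opp i) - 1) (b i) (b (opp i) - p) = p) := by
  obtain ⟨h1, h2, h3, h4, h5⟩ := h
  have rx := (hr i).of_succ h1.pos_left.le
  have ry := (hr (opp i)).of_succ h1.pos.le
  rw [sum_agents K i] at hK
  generalize b i = x at *
  generalize b (opp i) = y at *
  generalize K i = k at *
  generalize K (opp i) = l at *
  match k, l with
  | 0, l =>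
    obtain rfl : l = n + 1 := by omega
    have hx : x = p := by simpa using h4.symm
    have := crit_of_lowerHalf_zero (i := i) h1 rx ry
    exact Or.inl ⟨rfl, this.1.trans hx, hx ▸ this.2⟩
  | k + 1, 0 => omega
  | k + 1, l + 1 =>
    push_cast at h2 h4
    have g := crit_equal_share (v := v) (n := n) (i := i) (by omega) h1 (by linarith)
      (by rw [h3]; linarith) rx ry
    rw [h3] at g
    obtain ⟨g1, g2, g3⟩ := g
    rcases Nat.eq_zero_or_pos l with h0 | h0
    · exact Or.inr (Or.inl ⟨by omega, by omega, g1, g2 h0⟩)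
    · exact Or.inr (Or.inr ⟨by omega, by omega, g1, (g3 h0).1, (g3 h0).2⟩)

/-- Agent `i` wins an item during a Type II-B tie. -/
theorem EqualShare.lose {p : ℝ} {K : Agent → ℕ} {b : Agent → ℝ} (h : EqualShare i p K b)
    (hi : 0 < K i) :
    p ≤ b i ∧ EqualShare i p (pair i (K i - 1) (K (opp i))) (pair i (b i - p) (b (opp i))) := by
  obtain ⟨h1, h2, h3, h4, h5⟩ := h
  have hp : 0 < p := h3 ▸ h1.leftover_pos
  have hl : 0 < K (opp i) := by omega
  obtain ⟨k, hk⟩ : ∃ k, K i = k + 1 := ⟨K i - 1, by omega⟩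
  obtain ⟨l, hl⟩ : ∃ l, K (opp i) = l + 1 := ⟨K (opp i) - 1, by omega⟩
  rw [hk, hl] at h1 h2 h3
  rw [hk] at h4
  push_cast at h2 h4
  have hpr := price_of_equal_share h1 (by rw [h3]; linarith)
  rw [h3] at hpr
  have hX := h1.lose
  have hs := h1.lose_strict (by linarith)
  rw [leftover_succ] at h3
  rw [hpr] at hX hs h3
  refine ⟨by linarith [hX.pos_left], ?_, ?_, ?_, ?_, ?_⟩ <;>
    simp only [pair_self, pair_of_opp, hk, hl, Nat.add_sub_cancel]
  · exact hX
  · push_cast; linarith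
  · exact h3
  · linarith
  · omega

/-- The opponent wins an item during a Type II-B tie. -/
theorem EqualShare.win {p : ℝ} {K : Agent → ℕ} {b : Agent → ℝ} (h : EqualShare i p K b)
    (hl : 0 < K (opp i)) (hY : K i = 0 ∨ 1 < K (opp i) ∧
      leftover (K i) (K (opp i) - 1) (b i) (b (opp i) - p) = p) :
    p ≤ b (opp i) ∧
      EqualShare i p (pair i (K i) (K (opp i) - 1)) (pair i (b i) (b (opp i) - p)) := by
  obtain ⟨h1, h2, h3, h4, h5⟩ := h
  have hp : 0 < p := h3 ▸ h1.leftover_pos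
  obtain ⟨l, hl⟩ : ∃ l, K (opp i) = l + 1 := ⟨K (opp i) - 1, by omega⟩
  rcases Nat.eq_zero_or_pos (K i) with hk | hk
  · rw [hk, hl] at h1 h2
    rw [hk] at h4
    push_cast at h4 h2
    have hbp : b i = p := by linarith
    rw [hbp] at h1 h2
    obtain ⟨g1, g2⟩ := h1.second_phase
    refine ⟨g1.le, ?_, ?_, ?_, ?_, ?_⟩ <;>
      simp only [pair_self, pair_of_opp, hk, hl, Nat.add_sub_cancel, hbp]
    · exact g2
    · push_cast; linarith
    · rw [leftover_zero]
    · push_cast; linarith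
    · exact Or.inl trivial
  · obtain ⟨hl1, hY⟩ := hY.resolve_left hk.ne'
    obtain ⟨k, hk⟩ : ∃ k, K i = k + 1 := ⟨K i - 1, by omega⟩
    rw [hk, hl] at h1 h2 h3
    rw [hk, hl, Nat.add_sub_cancel] at hY
    rw [hk] at h4
    push_cast at h2 h4
    have hpr := price_of_equal_share h1 (by rw [h3]; linarith)
    rw [h3] at hpr
    have hfl := h1.win_of_pos (by rw [hpr, hY]; exact hp)
    have hW := h1.win hfl
    have hs := h1.win_strict (by linarith)
    rw [hpr] at hW hs
    refine ⟨by linarith [hW.pos], ?_, ?_, ?_, ?_, ?_⟩ <;>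
      simp only [pair_self, pair_of_opp, hk, hl, Nat.add_sub_cancel]
    · exact hW
    · push_cast; linarith
    · exact hY
    · push_cast; linarith
    · omega

theorem EqualShare.step {n : ℕ} {p : ℝ} {K : Agent → ℕ} {b : Agent → ℝ} {w : Agent}
    (h : EqualShare i p K b) (hK : K 0 + K 1 = n + 1) (hr : ∀ j, Rich v (n + 1) (b j))
    (hwin : ¬ (canonBid v n b (opp w)).Beats (canonBid v n b w)) :
    (canonBid v n b w).amount = p ∧
      ∃ K', EqualShare i p K' (pay b w p) ∧ K' w + 1 = K w ∧ K' (opp w) = K (opp w) := by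
  obtain ⟨hle, hamt⟩ := winner_spec hwin
  rw [hamt]
  have key := h.crit_cases hK hr
  rcases eq_or_eq_opp i w with rfl | rfl
  · have hw : 0 < K w ∧ crit v n (opp w) (b (opp w)) (b w) = p := by
      rcases key with ⟨-, h1, h2⟩ | ⟨h1, -, h2, -⟩ | ⟨h1, -, h2, -⟩
      · exact absurd hle (not_le.mpr (by rw [h1]; exact h2))
      · exact ⟨h1, h2⟩
      · exact ⟨h1, h2⟩
    obtain ⟨g1, g2⟩ := h.lose hw.1
    refine ⟨hw.2, _, ?_, ?_, pair_of_opp w (K w - 1) (K (opp w))⟩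
    · convert g2
      conv_lhs => rw [← pair_eta w b]
      rw [pay_pair, max_eq_left (by linarith)]
    · rw [pair_self]; omega
  · rw [opp_opp] at hle ⊢
    have hw : crit v n i (b i) (b (opp i)) = p ∧ (K i = 0 ∨ 1 < K (opp i) ∧
        leftover (K i) (K (opp i) - 1) (b i) (b (opp i) - p) = p) := by
      rcases key with ⟨h0, h1, h2⟩ | ⟨-, -, h1, h2⟩ | ⟨-, h0, -, h1, h2⟩
      · exact ⟨h1, Or.inl h0⟩
      · exact absurd hle (not_le.mpr (by rw [h1]; exact h2))
      · exact ⟨h1, Or.inr ⟨h0, h2⟩⟩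
    have hl : 0 < K (opp i) := by
      have := sum_agents K i
      rcases hw.2 with h0 | h0 <;> omega
    obtain ⟨g1, g2⟩ := h.win hl hw.2
    refine ⟨hw.1, _, ?_, ?_, pair_self i (K i) (K (opp i) - 1)⟩
    · convert g2
      conv_lhs => rw [← pair_eta i b]
      rw [pay_pair_opp, max_eq_left (by linarith)]
    · rw [pair_of_opp]; omega

/-- Type II-B ties. -/
theorem EqualShare.typeIIBTie {p : ℝ} {K : Agent → ℕ} {b : Agent → ℝ}
    (h : EqualShare i p K b) (hr : ∀ j, Rich v (K 0 + K 1) (b j)) : TypeIIBTie v K i b p := by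
  have hp : 0 < p := h.leftover_eq ▸ h.lower.leftover_pos
  intro g m c hg
  obtain ⟨K', ⟨h1, h2⟩, hK', hcount⟩ := hg.invariant_counts
    (Inv := fun K c => (∀ j, Rich v (K 0 + K 1) (c j)) ∧ EqualShare i p K c) (by
    rintro n K c w hn ⟨g1, g2⟩ hwin
    rw [hn] at g1
    obtain ⟨e1, K', e2, e3, e4⟩ := g2.step hn g1 hwin
    rw [e1]
    refine ⟨K', ⟨fun j => ?_, e2⟩, e3, e4⟩
    have : K' 0 + K' 1 = n := by
      rw [sum_agents K w] at hn
      rw [sum_agents K' w]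
      omega
    rw [this]
    exact ((g1 j).of_succ (g2.budget_nonneg j)).mono (pay_le hp.le (g2.budget_nonneg w) j))
    rfl ⟨hr, h⟩
  rw [hK'] at h1
  have hi := hcount i
  have ho := hcount (opp i)
  rcases h2.crit_cases hK' h1 with ⟨h0, e1, e2⟩ | ⟨h0, h0', e1, e2⟩ | ⟨h0, h0', e1, e2, -⟩
  · refine Or.inr (Or.inl ⟨by omega, ?_, canonBid_lower e1 e2, canonBid_higher e1 e2⟩)
    have := h2.budget
    rw [h0] at this
    simpa using this.symm
  · refine Or.inr (Or.inr ⟨by omega, by omega, ?_, ?_⟩)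
    · have := canonBid_higher (i := opp i) (b := c) (p := p) (v := v) (m := m)
        (by rw [opp_opp]; exact e1) (by rw [opp_opp]; exact e2)
      rwa [opp_opp] at this
    · exact canonBid_lower (by rw [opp_opp]; exact e1) (by rw [opp_opp]; exact e2)
  · refine Or.inl ⟨by omega, by omega, fun j => ?_⟩
    rcases eq_or_eq_opp i j with rfl | rfl
    · exact canonBid_tie e2 e1
    · exact canonBid_tie (by rw [opp_opp]; exact e1) (by rw [opp_opp]; exact e2)

/-- In the lower half of a cell, all realizations have two phases, or a Type II-B tie occurs. -/
theorem twoPhase_or_tie {n : ℕ} (hn : k + l = n) (h : LowerHalf k l x y)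
    (hs : (l + 1) * x < (k + 1) * y) (hrx : Rich v n x) (hry : Rich v n y) :
    (∀ h c, Reach v n (pair i x y) h 0 c → IsTwoPhase (pair i k l) i (pair i x y) h) ∨
    ∃ g m d, Reach v n (pair i x y) g m d ∧ g.length < k ∧ (∀ x ∈ g, x.1 = i) ∧
      (∀ h c, Reach v n (pair i x y) h 0 c → g <+: h) ∧
      TypeIIBTie v (pair i (k - g.length) l) i d (d i / ((k : ℝ) - g.length + 1)) := by
  induction k generalizing n x with
  | zero =>
    obtain rfl : l = n := by omega
    obtain ⟨-, hu⟩ := reach_second_phase (i := i) h hrx hry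
    exact Or.inl fun g c hg => by rw [hu g c hg]; exact isTwoPhase_second i l x y
  | succ k ih =>
    obtain ⟨n, rfl⟩ : ∃ n', n = n' + 1 := ⟨k + l, by omega⟩
    have rx := hrx.of_succ h.pos_left.le
    have ry := hry.of_succ h.pos.le
    -- the first agent certainly wins the first item
    have sure : ∀ p, 0 ≤ p → p ≤ x → crit v n (opp i) y x = p → p < crit v n i x y →
        LowerHalf k l (x - p) y → (l + 1) * (x - p) < (k + 1) * y →
        (∀ h c, Reach v (n + 1) (pair i x y) h 0 c →
          IsTwoPhase (pair i (k + 1) l) i (pair i x y) h) ∨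
        ∃ g m d, Reach v (n + 1) (pair i x y) g m d ∧ g.length < k + 1 ∧ (∀ x ∈ g, x.1 = i) ∧
          (∀ h c, Reach v (n + 1) (pair i x y) h 0 c → g <+: h) ∧
          TypeIIBTie v (pair i (k + 1 - g.length) l) i d
            (d i / (((k + 1 : ℕ) : ℝ) - g.length + 1)) := by
      intro p hp0 hpx h1 h2 h3 h4
      rcases ih (by omega) h3 h4 (rx.mono (by linarith)) ry with
        hall | ⟨g, m, d, g1, g2, g3, g4, g5⟩
      · left
        intro g c hg
        obtain ⟨g', rfl, hg'⟩ := hg.uncons h1 h2 hpx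
        exact (hall g' c hg').cons
      · refine Or.inr ⟨(i, p) :: g, m, d, g1.cons h1 h2.le hpx, by simpa using g2, ?_, ?_, ?_⟩
        · intro z hz
          rcases List.mem_cons.mp hz with rfl | hz
          · rfl
          · exact g3 z hz
        · intro h' c hg
          obtain ⟨g', rfl, hg'⟩ := hg.uncons h1 h2 hpx
          exact List.cons_prefix_cons.mpr ⟨rfl, g4 g' c hg'⟩
        · rw [List.length_cons, Nat.add_sub_add_right]
          push_cast
          rwa [add_sub_add_right_eq_sub]
    match l with
    | 0 =>
      have hc := h.cell
      have hh := h.half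
      push_cast at hc hh hs
      obtain ⟨h1, h2⟩ := (utilSpec v n).crit_poor (i := opp i) h.pos.le (by
        rw [show n = k by omega]; linarith) ry rx
      rw [opp_opp] at h2
      exact sure y h.pos.le h.le_left.le h1 h2
        ⟨h.pos, by push_cast; linarith, by push_cast; linarith⟩ (by push_cast; linarith)
    | l + 1 =>
      push_cast at hs
      have hp := h.leftover_pos.trans_le (leftover_le_price h)
      have hX := h.lose
      obtain ⟨h1, h2, h3⟩ := (utilSpec v n).crit_lower (i := i) (by omega) h (by linarith) rx ry
      have hsX := h.lose_strict (by linarith)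
      by_cases hlt : leftover (k + 1) l x (y - price k l x y) < leftover (k + 1) (l + 1) x y
      · exact sure _ hp.le (by linarith [hX.pos_left]) h1 (h2 hlt) hX (by push_cast; linarith)
      · have heq : (k + 2) * leftover (k + 1) (l + 1) x y = x := by
          match l with
          | 0 => exact absurd (won_lt_lost h (by push_cast at hs; linarith)) hlt
          | l + 1 =>
            exact leftover_of_won_eq_lost h ((won_le_lost h).antisymm (not_lt.mp hlt))
        refine Or.inr ⟨[], n + 1, pair i x y, Reach.refl _ _, by simp, by simp,
          fun _ _ _ => List.nil_prefix, ?_⟩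
        have hsum : pair i (k + 1) (l + 1) 0 + pair i (k + 1) (l + 1) 1 = n + 1 := by
          rw [sum_agents _ i, pair_self, pair_of_opp]; omega
        have hshare : EqualShare i (x / (k + 2)) (pair i (k + 1) (l + 1)) (pair i x y) := by
          refine ⟨?_, ?_, ?_, ?_, ?_⟩ <;> simp only [pair_self, pair_of_opp]
          · exact h
          · push_cast; linarith
          · rw [eq_div_iff (by positivity)]; linarith
          · push_cast; field_simp; ring
          · exact Or.inr (Nat.succ_pos l)
        have := hshare.typeIIBTie (v := v) (by
          rw [hsum]
          intro j
          rcases eq_or_eq_opp i j with rfl | rfl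
          · rwa [pair_self]
          · rwa [pair_of_opp])
        have e : pair i x y i / (((k + 1 : ℕ) : ℝ) - ([] : List (Agent × ℝ)).length + 1) =
            x / (k + 2) := by
          rw [pair_self, List.length_nil]
          congr 1
          push_cast
          ring
        rw [e]
        exact this

end LowerHalf

/-! ### Translation to the two agents and assembly of the cases. -/

section Agents

variable {v : Agent → ℝ} {K : Agent → ℕ} {b : Agent → ℝ} {i : Agent}

theorem twoPhasePossible_of_lowerHalf (hr : ∀ j, Rich v (K 0 + K 1) (b j))
    (h : LowerHalf (K i) (K (opp i)) (b i) (b (opp i))) : TwoPhasePossible v K i b := by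
  have := exists_twoPhase (i := i) (sum_agents K i).symm h (hr i) (hr (opp i))
  rwa [pair_eta, pair_eta] at this

theorem twoPhaseOrTie_of_lowerHalf (hr : ∀ j, Rich v (K 0 + K 1) (b j))
    (h : LowerHalf (K i) (K (opp i)) (b i) (b (opp i)))
    (hs : (K (opp i) + 1) * b i < (K i + 1) * b (opp i)) : TwoPhaseOrTie v K i b := by
  have := twoPhase_or_tie (i := i) (sum_agents K i).symm h hs (hr i) (hr (opp i))
  simp only [pair_eta] at this
  have e : ∀ q, pair i q (K (opp i)) = Function.update K i q := by
    intro q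
    funext j
    rcases eq_or_eq_opp i j with rfl | rfl
    · simp [pair_self]
    · simp [pair_of_opp, opp_ne]
  simp only [e] at this
  exact this

theorem lowerHalf_results (hr : ∀ j, Rich v (K 0 + K 1) (b j))
    (h : LowerHalf (K i) (K (opp i)) (b i) (b (opp i)))
    (hs : (K (opp i) + 1) * b i < (K i + 1) * b (opp i)) :
    TwoPhasePossible v K i b ∧ TwoPhaseOrTie v K i b ∧ TiesIrrelevant v K b :=
  ⟨twoPhasePossible_of_lowerHalf hr h, twoPhaseOrTie_of_lowerHalf hr h hs,
    tiesIrrelevant_of_inCell hr h.inCell⟩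

theorem lowerHalf_of_mid {p : ℝ} (hp : 0 < p) (hb : ∀ j, b j = p * (K j + 1)) (i : Agent) :
    LowerHalf (K i) (K (opp i)) (b i) (b (opp i)) := by
  rw [hb, hb]
  refine ⟨by positivity, ?_, le_of_eq (by ring)⟩
  nlinarith [mul_pos hp (show (0 : ℝ) < K (opp i) + 1 by positivity)]

/-- Close to the middle of the cell, there is a Type II-B tie. -/
theorem near_mid_results (hb : ∀ j, 0 < b j) (hr : ∀ j, Rich v (K 0 + K 1) (b j))
    (hl : 0 < K (opp i)) (hs : (K (opp i) + 1) * b i < (K i + 1) * b (opp i))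
    (hnear : K i * ((K i + 1) * b (opp i) - (K (opp i) + 1) * b i) ≤ b i) :
    TypeIIBTie v K i b (b i / (K i + 1)) ∧ TwoPhasePossible v K i b ∧ TiesIrrelevant v K b := by
  have hx := hb i
  have hy := hb (opp i)
  have hcell : (K i : ℝ) * b (opp i) < (K (opp i) + 1) * b i := by
    have h1 : (1 : ℝ) ≤ K (opp i) := by exact_mod_cast hl
    have h2 : ((K i : ℝ) + 1) * (K i * b (opp i)) < (K i + 1) * ((K (opp i) + 1) * b i) := by
      nlinarith
    exact lt_of_mul_lt_mul_left h2 (by positivity)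
  have h : LowerHalf (K i) (K (opp i)) (b i) (b (opp i)) := ⟨hy, hcell, hs.le⟩
  have hshare : EqualShare i (b i / (K i + 1)) K b := by
    refine ⟨h, hs, ?_, by field_simp, Or.inr hl⟩
    -- With s the equal share, the opponent's budget exceeds its middle-line value by some e, and
    -- the nearness hypothesis becomes k e ≤ s as in `leftover_near_mid`.
    set s := b i / ((K i : ℝ) + 1) with hsdef
    have e1 : b i = (K i + 1) * s := by rw [hsdef]; field_simp
    have e2 : b (opp i) = (K (opp i) + 1) * s + (b (opp i) - (K (opp i) + 1) * s) := by ring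
    rw [e1] at hs hnear
    rw [e1, e2]
    apply leftover_near_mid hl (by positivity)
    · have h3 : (K i + 1 : ℝ) * 0 < (K i + 1) * (b (opp i) - (K (opp i) + 1) * s) := by linarith
      exact (lt_of_mul_lt_mul_left h3 (by positivity)).le
    · have h3 : ((K i : ℝ) + 1) * (K i * (b (opp i) - (K (opp i) + 1) * s)) ≤ (K i + 1) * s := by
        linarith
      exact le_of_mul_le_mul_left h3 (by positivity)
  exact ⟨hshare.typeIIBTie hr, twoPhasePossible_of_lowerHalf hr h,
    tiesIrrelevant_of_inCell hr h.inCell⟩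

end Agents

/-- The upper bound on the ratio is multiplied out so that k 1 = 0 imposes no condition. Cases 2 and
4 are the same lower-half result applied to agent 1 and to agent 2. -/
theorem mainTheorem3 (k : Agent → ℕ) :
    (∀ v b : Agent → ℝ, (∀ j, 0 < b j) → (∀ i j, 2 ^ (k 0 + k 1) * b j < v i) →
      (k 0 : ℝ) / (k 1 + 1) ≤ b 0 / b 1 → b 0 * k 1 < (k 0 + 1) * b 1 →
      -- Case 1: Type I tie-breaking
      (b 0 / b 1 = (k 0 : ℝ) / (k 1 + 1) →
        b 0 / k 0 = b 1 / (k 1 + 1) ∧ TypeITie v (k 0 + k 1) b (b 0 / k 0)) ∧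
      -- Case 2: agent 1 wins first
      ((k 0 : ℝ) / (k 1 + 1) < b 0 / b 1 → b 0 / b 1 < ((k 0 : ℝ) + 1) / (k 1 + 1) →
        TwoPhasePossible v k 0 b ∧ TwoPhaseOrTie v k 0 b ∧ TiesIrrelevant v k b) ∧
      -- Case 3: Type II-A tie-breaking
      (b 0 / b 1 = ((k 0 : ℝ) + 1) / (k 1 + 1) →
        b 0 / (k 0 + 1) = b 1 / (k 1 + 1) ∧ TypeIIATie v (k 0 + k 1) b (b 0 / (k 0 + 1)) ∧
        TwoPhasePossible v k 0 b ∧ TwoPhasePossible v k 1 b ∧ TiesIrrelevant v k b) ∧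
      -- Case 4: agent 2 wins first
      (((k 0 : ℝ) + 1) / (k 1 + 1) < b 0 / b 1 →
        TwoPhasePossible v k 1 b ∧ TwoPhaseOrTie v k 1 b ∧ TiesIrrelevant v k b)) ∧
    -- Type II-B tie-breaking
    (∀ i : Agent, 1 ≤ k (opp i) → ∃ δ : ℝ, 0 < δ ∧
      ∀ v b : Agent → ℝ, (∀ j, 0 < b j) → (∀ i j, 2 ^ (k 0 + k 1) * b j < v i) →
        ((k i : ℝ) + 1) / (k (opp i) + 1) - δ < b i / b (opp i) →
        b i / b (opp i) < ((k i : ℝ) + 1) / (k (opp i) + 1) →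
        TypeIIBTie v k i b (b i / (k i + 1)) ∧ TwoPhasePossible v k i b ∧
          TiesIrrelevant v k b) := by
  refine ⟨?_, ?_⟩
  · intro v b hb hv hlow hup
    have hr : ∀ j, Rich v (k 0 + k 1) (b j) := fun j i => hv i j
    have h0 := hb 0
    have h1 := hb 1
    refine ⟨fun heq => ?_, fun hlt1 hlt2 => ?_, fun heq => ?_, fun hlt => ?_⟩
    · rw [div_eq_div_iff h1.ne' (by positivity)] at heq
      have hk : 0 < k 0 := by
        rcases Nat.eq_zero_or_pos (k 0) with h | h
        · rw [h] at heq
          have : 0 < b 0 * ((k 1 : ℝ) + 1) := by positivity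
          simp at heq
          rcases heq with h | h <;> linarith
        · exact h
      have hk' : (0 : ℝ) < k 0 := by exact_mod_cast hk
      have hp : b 0 / k 0 = b 1 / (k 1 + 1) := by
        rw [div_eq_div_iff hk'.ne' (by positivity)]; linarith
      refine ⟨hp, ?_⟩
      -- The budgets are p k₁ and p (k₂ + 1), so the multiplicities are (k₁, k₂ + 1), adding up to
      -- one more than the number of items.
      refine typeITie_of_boundary (K := pair 0 (k 0) (k 1 + 1)) (by positivity) hr ?_ ?_ ?_
      · rw [sum_agents _ 0, pair_self, pair_of_opp]; omega
      · intro j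
        rcases eq_or_eq_opp 0 j with rfl | rfl
        · rwa [pair_self]
        · rw [pair_of_opp]; omega
      · intro j
        rcases eq_or_eq_opp 0 j with rfl | rfl
        · rw [pair_self]; field_simp
        · rw [pair_of_opp, hp]
          change b 1 = _
          push_cast
          field_simp
    · rw [div_lt_div_iff₀ (by positivity) h1] at hlt1
      rw [div_lt_div_iff₀ h1 (by positivity)] at hlt2
      have hs : ((k (opp 0) : ℝ) + 1) * b 0 < (k 0 + 1) * b (opp 0) := by
        change ((k 1 : ℝ) + 1) * b 0 < (k 0 + 1) * b 1
        linarith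
      refine lowerHalf_results hr ⟨hb _, ?_, hs.le⟩ hs
      change (k 0 : ℝ) * b 1 < (k 1 + 1) * b 0
      linarith
    · rw [div_eq_div_iff h1.ne' (by positivity)] at heq
      have hp : b 0 / (k 0 + 1) = b 1 / (k 1 + 1) := by
        rw [div_eq_div_iff (by positivity) (by positivity)]; linarith
      have hp0 : 0 < b 0 / ((k 0 : ℝ) + 1) := by positivity
      have hbj : ∀ j, b j = b 0 / (k 0 + 1) * (k j + 1) := by
        intro j
        rcases eq_or_eq_opp 0 j with rfl | rfl
        · field_simp
        · rw [hp]
          change b 1 = b 1 / (k 1 + 1) * (k 1 + 1)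
          field_simp
      have hL := lowerHalf_of_mid hp0 hbj
      exact ⟨hp, typeIIATie_of_mid hp0 hr rfl hbj, twoPhasePossible_of_lowerHalf hr (hL 0),
        twoPhasePossible_of_lowerHalf hr (hL 1), tiesIrrelevant_of_inCell hr (hL 0).inCell⟩
    · rw [div_lt_div_iff₀ (by positivity) h1] at hlt
      have hs : ((k (opp 1) : ℝ) + 1) * b 1 < (k 1 + 1) * b (opp 1) := by
        change ((k 0 : ℝ) + 1) * b 1 < (k 1 + 1) * b 0
        linarith
      refine lowerHalf_results hr ⟨hb _, ?_, hs.le⟩ hs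
      change (k 1 : ℝ) * b 0 < (k 0 + 1) * b 1
      linarith
  · intro i hl
    -- With k, l for `k i`, `k (opp i)`, this δ turns the lower bound on the ratio into
    -- k(k+1)/(k(l+1)+1), which is the hypothesis k((k+1) y - (l+1) x) ≤ x of `near_mid_results`
    -- solved for x/y.
    refine ⟨((k i : ℝ) + 1) / ((k (opp i) + 1) * (k i * (k (opp i) + 1) + 1)), by positivity, ?_⟩
    intro v b hb hv hlow hup
    have hx := hb i
    have hy := hb (opp i)
    have e : ((k i : ℝ) + 1) / (k (opp i) + 1) -
        (k i + 1) / ((k (opp i) + 1) * (k i * (k (opp i) + 1) + 1)) =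
        k i * (k i + 1) / (k i * (k (opp i) + 1) + 1) := by
      field_simp
      ring
    rw [e, div_lt_div_iff₀ (by positivity) hy] at hlow
    rw [div_lt_div_iff₀ hy (by positivity)] at hup
    exact near_mid_results hb (fun j i => hv i j) hl (by linarith) (by linarith)
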